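/- Let $X$ be a nonsingular algebraic variety over an algebraically closed field $k$ of characteristic $0$, let $D\subset X$ be a reduced effective divisor, and let $i\colon D\to X$ be the inclusion. Let $D^s$ be the singular subscheme of $D$: its ideal sheaf $\tilde{\mathscr I}\subseteq\mathscr O_X$ (the Jacobian ideal of $D$) is generated, where $h$ is a local equation of $D$, by $h$ and all derivatives $\theta h$ of $h$ along $k$-derivations $\theta$ of $\mathscr O_X$; let $\mathscr I=\tilde{\mathscr I}\,\mathscr O_D$ be the ideal sheaf of $D^s$ in $\mathscr O_D$. Suppose that $\tilde{\mathscr I}$ is of linear type, i.e. that the canonical epimorphism $\mathrm{Sym}_{\mathscr O_X}(\tilde{\mathscr I})\to\mathrm{Rees}_{\mathscr O_X}(\tilde{\mathscr I})=\bigoplus_{n\ge 0}\tilde{\mathscr I}^{\,n}$ is an isomorphism. Then there is an isomorphism of schemes over $X$ $$\mathrm{Proj}\big(\mathrm{Sym}_{\mathscr O_X}(i_*\mathscr I)\big)\;\cong\;\mathrm{qBl}_{D^s}D .$$ Here, for a closed subscheme $W$ of a $k$-scheme $V$, the quasi-symmetric blow-up $\mathrm{qBl}_WV$ is $\mathrm{Proj}$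 of the quasi-symmetric blow-up algebra, the quasi-coherent graded $\mathscr O_V$-algebra whose sections over an affine open subset $\mathrm{Spec}\,A\subseteq V$, in which $W$ is defined by the ideal $I\subseteq A$, form the inverse limit, over all surjections of $k$-algebras $R\to A$ (that is, over all closed embeddings of $\mathrm{Spec}\,A$ in an affine ambient $k$-scheme $\mathrm{Spec}\,R$, possibly singular) and all homomorphisms of $k$-algebras compatible with these surjections, of the blow-up algebras $$A\oplus\bigoplus_{n\ge1}J^n/KJ^{n-1},\qquad K=\ker(R\to A),\quad J=\text{the preimage of } I \text{ in } R .$$ -/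

import Mathlib

universe u

set_option linter.style.haveILetI false
set_option linter.unusedSectionVars false

open CategoryTheory Limits AlgebraicGeometry

noncomputable section

namespace QuasiBlowup

section SymmetricAlgebra

open scoped DirectSum

variable {A A' A'' M M' M'' : Type*} [CommRing A] [CommRing A'] [CommRing A'']
  [AddCommMonoid M] [AddCommMonoid M'] [AddCommMonoid M''] [Module A M] [Module A' M']
  [Module A'' M'']

variable (A M) in
/-- The degree `n` part of the symmetric algebra: the span of the `n`-fold products of elements
of the module. -/
def symGrading (n : ℕ) : Submodule A (SymmetricAlgebra A M) :=
  LinearMap.range (SymmetricAlgebra.ι A M) ^ n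

instance : SetLike.GradedMonoid (symGrading A M) :=
  inferInstanceAs (SetLike.GradedMonoid
    ((LinearMap.range (SymmetricAlgebra.ι A M) ^ ·) : ℕ → Submodule A _))

lemma ι_mem_symGrading (m : M) : SymmetricAlgebra.ι A M m ∈ symGrading A M 1 := by
  simp [symGrading]

lemma algebraMap_mem_symGrading (a : A) :
    algebraMap A (SymmetricAlgebra A M) a ∈ symGrading A M 0 := by
  simp only [symGrading, pow_zero]
  exact Submodule.algebraMap_mem a

variable (A M) in
def symGradedι : M →ₗ[A] ⨁ i : ℕ, symGrading A M i :=
  DirectSum.lof A ℕ (fun i => symGrading A M i) 1 ∘ₗ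
    (SymmetricAlgebra.ι A M).codRestrict _ fun m => ι_mem_symGrading m

instance symGradedAlgebra : GradedAlgebra (symGrading A M) :=
  GradedAlgebra.ofAlgHom _ (SymmetricAlgebra.lift (symGradedι A M))
    (by
      ext m
      change DirectSum.coeAlgHom (symGrading A M)
        (SymmetricAlgebra.lift (symGradedι A M) (SymmetricAlgebra.ι A M m)) = _
      rw [SymmetricAlgebra.lift_ι_apply]
      exact DirectSum.coeAlgHom_of _ _ _)
    fun i x => by
      obtain ⟨x, hx⟩ := x
      dsimp only
      induction hx using Submodule.pow_induction_on_left' with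
      | algebraMap r => rw [AlgHom.commutes, DirectSum.algebraMap_apply]; rfl
      | add x y i hx hy ihx ihy => rw [map_add, ihx, ihy, ← map_add]; rfl
      | mem_mul m hm i x hx ih =>
        obtain ⟨m, rfl⟩ := hm
        rw [map_mul, ih, SymmetricAlgebra.lift_ι_apply]
        simp only [symGradedι, LinearMap.comp_apply, DirectSum.lof_eq_of]
        erw [DirectSum.of_mul_of]
        exact DirectSum.of_eq_of_gradedMonoid_eq (Sigma.subtype_ext (add_comm _ _) rfl)

lemma sym_ringHom_ext {B : Type*} [CommRing B] {f g : SymmetricAlgebra A M →+* B}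
    (h₀ : ∀ a, f (algebraMap A _ a) = g (algebraMap A _ a))
    (h₁ : ∀ m, f (SymmetricAlgebra.ι A M m) = g (SymmetricAlgebra.ι A M m)) : f = g := by
  refine RingHom.ext fun x => ?_
  induction x using SymmetricAlgebra.induction with
  | algebraMap r => exact h₀ r
  | ι x => exact h₁ x
  | mul a b ha hb => rw [map_mul, map_mul, ha, hb]
  | add a b ha hb => rw [map_add, map_add, ha, hb]

/-- The ring homomorphism out of a symmetric algebra determined by a ring homomorphism on the
scalars and a compatible additive map on the module. -/
def symLift {B : Type*} [CommRing B] (ρ : A →+* B) (g : M →+ B)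
    (hg : ∀ a m, g (a • m) = ρ a * g m) : SymmetricAlgebra A M →+* B :=
  letI := ρ.toAlgebra
  (SymmetricAlgebra.lift (A := B)
    { toFun := g, map_add' := map_add g, map_smul' := hg } : SymmetricAlgebra A M →ₐ[A] B).toRingHom

section
variable {B : Type*} [CommRing B] (ρ : A →+* B) (g : M →+ B)
    (hg : ∀ a m, g (a • m) = ρ a * g m)

@[simp] lemma symLift_algebraMap (a : A) : symLift ρ g hg (algebraMap A _ a) = ρ a := by
  letI := ρ.toAlgebra
  exact AlgHom.commutes (SymmetricAlgebra.lift (A := B)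
    { toFun := g, map_add' := map_add g, map_smul' := hg } : SymmetricAlgebra A M →ₐ[A] B) a

@[simp] lemma symLift_ι (m : M) : symLift ρ g hg (SymmetricAlgebra.ι A M m) = g m := by
  letI := ρ.toAlgebra
  exact SymmetricAlgebra.lift_ι_apply (A := B)
    { toFun := g, map_add' := map_add g, map_smul' := hg } m

end

/-- Functoriality of the symmetric algebra for semilinear maps. -/
def symMap (ρ : A →+* A') (g : M →ₛₗ[ρ] M') : SymmetricAlgebra A M →+* SymmetricAlgebra A' M' :=
  symLift ((algebraMap A' _).comp ρ) ((SymmetricAlgebra.ι A' M').toAddMonoidHom.comp g.toAddMonoidHom)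
    (by intro a m; simp [Algebra.smul_def])

@[simp] lemma symMap_algebraMap (ρ : A →+* A') (g : M →ₛₗ[ρ] M') (a : A) :
    symMap ρ g (algebraMap A _ a) = algebraMap A' _ (ρ a) :=
  symLift_algebraMap _ _ _ a

@[simp] lemma symMap_ι (ρ : A →+* A') (g : M →ₛₗ[ρ] M') (m : M) :
    symMap ρ g (SymmetricAlgebra.ι A M m) = SymmetricAlgebra.ι A' M' (g m) :=
  symLift_ι _ _ _ m

lemma symMap_mem (ρ : A →+* A') (g : M →ₛₗ[ρ] M') {n : ℕ} {x : SymmetricAlgebra A M}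
    (hx : x ∈ symGrading A M n) : symMap ρ g x ∈ symGrading A' M' n := by
  induction hx using Submodule.pow_induction_on_left' with
  | algebraMap r => rw [symMap_algebraMap]; exact algebraMap_mem_symGrading _
  | add x y i hx hy ihx ihy => rw [map_add]; exact add_mem ihx ihy
  | mem_mul m hm i x hx ih =>
    obtain ⟨m, rfl⟩ := hm
    rw [map_mul, symMap_ι, Nat.succ_eq_add_one, add_comm]
    exact SetLike.mul_mem_graded (ι_mem_symGrading _) ih

/-- If `A' = A_f` and `M' = M_f`, then `Sym_{A'} M'` is the localization of `Sym_A M` at `f`. -/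
lemma symMap_isLocalization (ρ : A →+* A') (g : M →ₛₗ[ρ] M') (f : A)
    (hρ : letI := ρ.toAlgebra; IsLocalization.Away f A')
    (hsurj : ∀ y, ∃ (n : ℕ) (x : M), ρ f ^ n • y = g x)
    (hinj : ∀ x y, g x = g y → ∃ n : ℕ, f ^ n • x = f ^ n • y) :
    letI := (symMap ρ g).toAlgebra
    IsLocalization.Away (algebraMap A (SymmetricAlgebra A M) f) (SymmetricAlgebra A' M') := by
  letI := ρ.toAlgebra
  letI : Module A M' := Module.compHom M' ρ
  haveI : IsScalarTower A A' M' := ⟨fun a b m => by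
    change (ρ a * b) • m = ρ a • b • m
    rw [mul_smul]⟩
  have hunit : IsUnit (ρ f) := IsLocalization.Away.algebraMap_isUnit f
  let gl : M →ₗ[A] M' :=
    { toFun := g, map_add' := map_add g, map_smul' := fun a m => g.map_smulₛₗ a m }
  haveI : IsLocalizedModule (.powers f) gl := by
    refine ⟨?_, ?_, ?_⟩
    · rintro ⟨_, n, rfl⟩
      rw [Module.End.isUnit_iff]
      have h1 : ∀ m : M', (algebraMap A (Module.End A M') (f ^ n)) m = (hunit.unit ^ n) • m := by
        intro m
        change ρ (f ^ n) • m = _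
        rw [map_pow]; rfl
      constructor
      · intro x y hxy
        change (algebraMap A (Module.End A M') (f ^ n)) x =
          (algebraMap A (Module.End A M') (f ^ n)) y at hxy
        rw [h1, h1] at hxy
        exact smul_left_cancel _ hxy
      · intro y
        refine ⟨(hunit.unit ^ n)⁻¹ • y, ?_⟩
        change (algebraMap A (Module.End A M') (f ^ n)) _ = y
        rw [h1, smul_inv_smul]
    · intro y
      obtain ⟨n, x, h⟩ := hsurj y
      refine ⟨(x, ⟨f ^ n, n, rfl⟩), ?_⟩
      change ρ (f ^ n) • y = g x
      rw [map_pow, h]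
    · intro x y hxy
      obtain ⟨n, hn⟩ := hinj x y hxy
      exact ⟨⟨f ^ n, n, rfl⟩, hn⟩
  have lift_exists : ∀ {L : Type _} [CommRing L] (l : SymmetricAlgebra A M →+* L),
      IsUnit (l (algebraMap A _ f)) →
        ∃ Ψ : SymmetricAlgebra A' M' →+* L, Ψ.comp (symMap ρ g) = l := by
    intro L _ l hl
    let lA : A →+* L := l.comp (algebraMap A _)
    have hFL : IsUnit (lA f) := hl
    let lA' : A' →+* L := IsLocalization.Away.lift (g := lA) f hFL
    have hlA' : ∀ a, lA' (ρ a) = lA a := fun a => IsLocalization.Away.lift_eq f hFL a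
    letI : Algebra A' L := lA'.toAlgebra
    letI : Algebra A L := lA.toAlgebra
    haveI : IsScalarTower A A' L := IsScalarTower.of_algebraMap_eq fun a => (hlA' a).symm
    let j : M →ₗ[A] L :=
      { toFun := fun m => l (SymmetricAlgebra.ι A M m)
        map_add' := fun x y => by rw [map_add, map_add]
        map_smul' := fun a m => by
          rw [Algebra.smul_def (A := L), map_smul, Algebra.smul_def, map_mul]; rfl }
    let j' : M' →ₗ[A] L := IsLocalizedModule.lift (.powers f) gl j (by
      rintro ⟨_, n, rfl⟩
      rw [Module.End.isUnit_iff]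
      have h1 : ∀ m : L, (algebraMap A (Module.End A L) (f ^ n)) m =
          ((hFL.unit ^ n : Lˣ) : L) * m := by
        intro m
        change (f ^ n) • m = _
        rw [Algebra.smul_def, map_pow]
        rfl
      constructor
      · intro x y hxy
        change (algebraMap A (Module.End A L) (f ^ n)) x =
          (algebraMap A (Module.End A L) (f ^ n)) y at hxy
        rw [h1, h1] at hxy
        exact (Units.mul_right_inj _).mp hxy
      · intro y
        refine ⟨((hFL.unit ^ n)⁻¹ : Lˣ) * y, ?_⟩
        change (algebraMap A (Module.End A L) (f ^ n)) _ = y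
        rw [h1, Units.mul_inv_cancel_left])
    have hj' : ∀ m, j' (g m) = j m := fun m => IsLocalizedModule.lift_apply (.powers f) gl j _ m
    let j'' : M' →ₗ[A'] L := j'.extendScalarsOfIsLocalization (.powers f) A'
    refine ⟨(SymmetricAlgebra.lift j'').toRingHom, sym_ringHom_ext ?_ ?_⟩
    · intro a
      simp only [RingHom.comp_apply, symMap_algebraMap]
      exact (AlgHom.commutes (SymmetricAlgebra.lift j'') _).trans (hlA' a)
    · intro m
      simp only [RingHom.comp_apply, symMap_ι]
      exact (SymmetricAlgebra.lift_ι_apply j'' _).trans (hj' m)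
  let F := algebraMap A (SymmetricAlgebra A M) f
  let L := Localization.Away F
  obtain ⟨Ψ, hΨ⟩ := lift_exists (algebraMap (SymmetricAlgebra A M) L)
    (IsLocalization.Away.algebraMap_isUnit F)
  letI := (symMap ρ g).toAlgebra
  have key : ∀ y, ∃ (n : ℕ) (x : SymmetricAlgebra A M),
      (algebraMap A' (SymmetricAlgebra A' M') (ρ f)) ^ n * y = symMap ρ g x := by
    intro y
    induction y using SymmetricAlgebra.induction with
    | algebraMap r =>
      obtain ⟨n, a, h⟩ := IsLocalization.Away.surj f r
      refine ⟨n, algebraMap _ _ a, ?_⟩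
      rw [symMap_algebraMap, ← map_pow, ← map_mul, mul_comm]
      exact congrArg _ h
    | ι x =>
      obtain ⟨n, a, h⟩ := hsurj x
      refine ⟨n, SymmetricAlgebra.ι A M a, ?_⟩
      rw [symMap_ι, ← h, map_smul, Algebra.smul_def, map_pow]
    | mul a b ha hb =>
      obtain ⟨n, x, hx⟩ := ha
      obtain ⟨m, y, hy⟩ := hb
      refine ⟨n + m, x * y, ?_⟩
      rw [map_mul, ← hx, ← hy]; ring
    | add a b ha hb =>
      obtain ⟨n, x, hx⟩ := ha
      obtain ⟨m, y, hy⟩ := hb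
      refine ⟨n + m, algebraMap _ _ f ^ m * x + algebraMap _ _ f ^ n * y, ?_⟩
      rw [map_add, map_mul, map_mul, ← hx, ← hy, map_pow, map_pow, symMap_algebraMap]; ring
  refine ⟨?_, ?_, ?_⟩
  · rintro ⟨_, n, rfl⟩
    change IsUnit (symMap ρ g (algebraMap A _ f ^ n))
    rw [map_pow, symMap_algebraMap]
    exact (hunit.map _).pow n
  · intro y
    obtain ⟨n, x, h⟩ := key y
    refine ⟨(x, ⟨_, n, rfl⟩), ?_⟩
    change y * symMap ρ g (algebraMap A _ f ^ n) = symMap ρ g x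
    rw [map_pow, symMap_algebraMap, mul_comm, h]
  · intro x y hxy
    have : algebraMap _ L x = algebraMap _ L y := by
      rw [← hΨ]; exact congrArg Ψ hxy
    exact (IsLocalization.eq_iff_exists (.powers F) L).mp this

end SymmetricAlgebra

section Quotient

open scoped DirectSum

variable {S : Type*} [CommRing S] {σ : Type*} [SetLike σ S] [AddSubgroupClass σ S]
  (𝒜 : ℕ → σ) [GradedRing 𝒜]

/-- The grading of a quotient of a graded ring by an ideal. -/
def quotGrading (I : Ideal S) (n : ℕ) : AddSubgroup (S ⧸ I) :=
  (AddSubgroup.ofClass (𝒜 n)).map (Ideal.Quotient.mk I).toAddMonoidHom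

lemma mem_quotGrading {I : Ideal S} {n : ℕ} {y : S ⧸ I} :
    y ∈ quotGrading 𝒜 I n ↔ ∃ x ∈ 𝒜 n, Ideal.Quotient.mk I x = y := Iff.rfl

variable {𝒜}

/-- The quotient of a graded ring by a homogeneous ideal is graded. -/
@[reducible]
def quotGradedRing {I : Ideal S} (hI : I.IsHomogeneous 𝒜) : GradedRing (quotGrading 𝒜 I) := by
  haveI hm : SetLike.GradedMonoid (quotGrading 𝒜 I) :=
    { one_mem := ⟨1, SetLike.one_mem_graded 𝒜, map_one (Ideal.Quotient.mk I)⟩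
      mul_mem := by
        rintro i j _ _ ⟨x, hx, rfl⟩ ⟨y, hy, rfl⟩
        exact ⟨x * y, SetLike.mul_mem_graded hx hy, map_mul (Ideal.Quotient.mk I) _ _⟩ }
  have hint : DirectSum.IsInternal (quotGrading 𝒜 I) := by
    constructor
    · rw [injective_iff_map_eq_zero]
      intro x hx
      classical
      have hch : ∀ i, ∃ a ∈ 𝒜 i, Ideal.Quotient.mk I a = (x i : S ⧸ I) := fun i => (x i).2
      choose a ha hax using hch
      rw [DirectSum.coeAddMonoidHom_eq_dfinsuppSum] at hx
      have h1 : ∑ i ∈ x.support, a i ∈ I := by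
        rw [← Ideal.Quotient.eq_zero_iff_mem, map_sum]
        rw [← hx]
        simp only [hax]
        rfl
      ext i
      by_cases hi : i ∈ x.support
      · have h2 := hI i h1
        rw [DirectSum.decompose_sum, DFinsupp.finsetSum_apply,
          AddSubmonoidClass.coe_finsetSum, Finset.sum_eq_single i] at h2
        · rw [DirectSum.decompose_of_mem_same 𝒜 (ha i)] at h2
          rw [← hax i, Ideal.Quotient.eq_zero_iff_mem.mpr h2]; rfl
        · intro j _ hj
          rw [DirectSum.decompose_of_mem_ne 𝒜 (ha j) hj]
        · exact fun h => absurd hi h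
      · rw [DFinsupp.notMem_support_iff.mp hi]; rfl
    · intro y
      classical
      obtain ⟨s, rfl⟩ := Ideal.Quotient.mk_surjective y
      refine ⟨∑ i ∈ (DirectSum.decompose 𝒜 s).support, DirectSum.of
        (fun i => quotGrading 𝒜 I i) i ⟨_, (DirectSum.decompose 𝒜 s i : S), SetLike.coe_mem _, rfl⟩, ?_⟩
      rw [map_sum]
      simp only [DirectSum.coeAddMonoidHom_of]
      conv_rhs => rw [← DirectSum.sum_support_decompose 𝒜 s, map_sum]
      rfl
  exact { hm, hint.chooseDecomposition with }

end Quotient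

section ProjBaseChange

open HomogeneousLocalization HomogeneousIdeal

variable {A A' S S' : Type u} [CommRing A] [CommRing A'] [CommRing S] [CommRing S']
  {σ τ : Type u} [SetLike σ S] [AddSubgroupClass σ S] [SetLike τ S'] [AddSubgroupClass τ S']
  (𝒜 : ℕ → σ) [GradedRing 𝒜] (ℬ : ℕ → τ) [GradedRing ℬ]

/-- The structure morphism `Proj S ⟶ Spec A` of a graded `A`-algebra `S`. -/
def projToSpec (α : A →+* S) (hα : ∀ a, α a ∈ 𝒜 0) : Proj 𝒜 ⟶ Spec (.of A) :=
  Proj.toSpecZero 𝒜 ≫ Spec.map (CommRingCat.ofHom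
    ({ toFun := fun a => ⟨α a, hα a⟩
       map_one' := Subtype.ext (map_one α)
       map_mul' := fun _ _ => Subtype.ext (map_mul α _ _)
       map_zero' := Subtype.ext (map_zero α)
       map_add' := fun _ _ => Subtype.ext (map_add α _ _) } : A →+* 𝒜 0))

variable {𝒜 ℬ}

/-- The degree zero constant `α a` as an element of the homogeneous localization at `s`. -/
def awayConst (α : A →+* S) (hα : ∀ a, α a ∈ 𝒜 0) (s : S) : A →+* Away 𝒜 s :=
  (fromZeroRingHom 𝒜 _).comp
    ({ toFun := fun a => ⟨α a, hα a⟩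
       map_one' := Subtype.ext (map_one α)
       map_mul' := fun _ _ => Subtype.ext (map_mul α _ _)
       map_zero' := Subtype.ext (map_zero α)
       map_add' := fun _ _ => Subtype.ext (map_add α _ _) } : A →+* 𝒜 0)

lemma awayConst_val (α : A →+* S) (hα : ∀ a, α a ∈ 𝒜 0) (s : S) (a : A) :
    (awayConst (𝒜 := 𝒜) α hα s a).val = algebraMap S _ (α a) := by
  change (fromZeroRingHom 𝒜 _ _).val = _
  simp only [fromZeroRingHom]
  exact (Localization.mk_one_eq_algebraMap _)

lemma awayι_projToSpec (α : A →+* S) (hα : ∀ a, α a ∈ 𝒜 0) {m : ℕ} (s : S) (hs : s ∈ 𝒜 m)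
    (hm : 0 < m) : Proj.awayι 𝒜 s hs hm ≫ projToSpec 𝒜 α hα =
      Spec.map (CommRingCat.ofHom (awayConst (𝒜 := 𝒜) α hα s)) := by
  rw [projToSpec, Proj.awayι_toSpecZero_assoc, ← Spec.map_comp]
  rfl

variable (φ : 𝒜 →+*ᵍ ℬ) (ρ : A →+* A') (α : A →+* S) (α' : A' →+* S')

/-- A homogeneous element of a localization at a degree zero element is, up to a power of that
element, the image of a homogeneous element of the same degree. -/
lemma exists_homogeneous_lift (hα : ∀ a, α a ∈ 𝒜 0) (f : A)
    (hS : letI := φ.toRingHom.toAlgebra; IsLocalization.Away (α f) S') {n : ℕ} {b : S'}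
    (hb : b ∈ ℬ n) : ∃ (N : ℕ) (a : S), a ∈ 𝒜 n ∧ φ a = φ (α f) ^ N * b := by
  letI := φ.toRingHom.toAlgebra
  obtain ⟨N, a, h⟩ := IsLocalization.Away.surj (α f) b
  have h' : φ a = φ (α f) ^ N * b := by rw [mul_comm]; exact h.symm
  refine ⟨N, DirectSum.decompose 𝒜 a n, SetLike.coe_mem _, ?_⟩
  rw [φ.map_directSumDecompose, h']
  have : φ (α f) ^ N * b ∈ ℬ n := by
    have h0 : φ (α f) ^ N ∈ ℬ 0 := by
      have := SetLike.pow_mem_graded N (φ.map_mem (hα f))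
      simpa using this
    simpa using SetLike.mul_mem_graded h0 hb
  exact DirectSum.decompose_of_mem_same ℬ this

/-- Localizing a graded ring at a degree zero element satisfies the condition under which `Proj`
is functorial. -/
lemma irrelevant_le_map (hα : ∀ a, α a ∈ 𝒜 0) (f : A)
    (hS : letI := φ.toRingHom.toAlgebra; IsLocalization.Away (α f) S') :
    HomogeneousIdeal.irrelevant ℬ ≤ (HomogeneousIdeal.irrelevant 𝒜).map φ := by
  letI := φ.toRingHom.toAlgebra
  rw [← toIdeal_le_toIdeal_iff, HomogeneousIdeal.toIdeal_irrelevant_le]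
  intro i hi b hb
  obtain ⟨N, a, ha, h⟩ := exists_homogeneous_lift φ α hα f hS hb
  have hu : IsUnit (φ (α f) ^ N) := (IsLocalization.Away.algebraMap_isUnit (α f)).pow N
  have hmem : φ a ∈ (HomogeneousIdeal.irrelevant 𝒜).toIdeal.map φ :=
    Ideal.mem_map_of_mem _ (HomogeneousIdeal.mem_irrelevant_of_mem 𝒜 hi ha)
  rw [h] at hmem
  exact (Ideal.unit_mul_mem_iff_mem _ hu).mp hmem

lemma awayMap_awayConst (hα : ∀ a, α a ∈ 𝒜 0) (hα' : ∀ a, α' a ∈ ℬ 0)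
    (comm : ∀ a, φ (α a) = α' (ρ a)) {m : ℕ} (s : S) (hs : s ∈ 𝒜 m) (a : A) :
    Away.map φ s (awayConst (𝒜 := 𝒜) α hα s a) = awayConst (𝒜 := ℬ) α' hα' (φ s) (ρ a) := by
  have h0 : α a ∈ 𝒜 (0 • m) := by simpa using hα a
  have : awayConst (𝒜 := 𝒜) α hα s a = Away.mk 𝒜 hs 0 (α a) h0 := by
    apply HomogeneousLocalization.val_injective
    rw [awayConst_val, Away.val_mk, ← Localization.mk_one_eq_algebraMap]
    congr 1
    exact Subtype.ext (pow_zero s).symm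
  rw [this, Away.map_mk]
  apply HomogeneousLocalization.val_injective
  rw [awayConst_val, Away.val_mk, comm, ← Localization.mk_one_eq_algebraMap]
  congr 1
  exact Subtype.ext (pow_zero _)

lemma awayMap_isLocalization (hα : ∀ a, α a ∈ 𝒜 0) (hα' : ∀ a, α' a ∈ ℬ 0)
    (comm : ∀ a, φ (α a) = α' (ρ a)) (f : A)
    (hS : letI := φ.toRingHom.toAlgebra; IsLocalization.Away (α f) S')
    (hρ : IsUnit (ρ f)) {m : ℕ} (s : S) (hs : s ∈ 𝒜 m) :
    letI := (Away.map φ s).toAlgebra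
    IsLocalization.Away (awayConst (𝒜 := 𝒜) α hα s f) (Away ℬ (φ s)) := by
  letI := φ.toRingHom.toAlgebra
  letI := (Away.map φ s).toAlgebra
  have hconst := awayMap_awayConst φ ρ α α' hα hα' comm s hs
  have hu : IsUnit (φ (α f)) := IsLocalization.Away.algebraMap_isUnit (α f)
  refine ⟨?_, ?_, ?_⟩
  · rintro ⟨_, n, rfl⟩
    change IsUnit (Away.map φ s (awayConst (𝒜 := 𝒜) α hα s f ^ n))
    rw [map_pow, hconst]
    exact (hρ.map _).pow n
  · intro y
    obtain ⟨n, b, hb, rfl⟩ := Away.mk_surjective ℬ (φ.map_mem hs) y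
    obtain ⟨N, a, ha, h⟩ := exists_homogeneous_lift φ α hα f hS hb
    refine ⟨(Away.mk 𝒜 hs n a ha, ⟨_, N, rfl⟩), ?_⟩
    change _ * Away.map φ s (awayConst (𝒜 := 𝒜) α hα s f ^ N) = Away.map φ s _
    rw [map_pow, hconst, Away.map_mk]
    apply HomogeneousLocalization.val_injective
    rw [HomogeneousLocalization.val_mul, HomogeneousLocalization.val_pow, awayConst_val,
      Away.val_mk, Away.val_mk, h, ← comm, mul_comm, ← map_pow,
      ← Localization.mk_one_eq_algebraMap, Localization.mk_mul, one_mul]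
    rfl
  · intro x y hxy
    obtain ⟨z, hz⟩ : ∃ z, z = x - y := ⟨_, rfl⟩
    have hz0 : Away.map φ s z = 0 := by
      rw [hz, map_sub, sub_eq_zero]; exact hxy
    suffices H : ∃ N : ℕ, awayConst (𝒜 := 𝒜) α hα s f ^ N * z = 0 by
      obtain ⟨N, hN⟩ := H
      refine ⟨⟨_, N, rfl⟩, ?_⟩
      rwa [hz, mul_sub, sub_eq_zero] at hN
    obtain ⟨n, a, ha, rfl⟩ := Away.mk_surjective 𝒜 hs z
    rw [Away.map_mk] at hz0
    have hz1 := congrArg HomogeneousLocalization.val hz0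
    rw [Away.val_mk, HomogeneousLocalization.val_zero, Localization.mk_eq_mk',
      IsLocalization.mk'_eq_zero_iff] at hz1
    obtain ⟨⟨_, k, rfl⟩, hk⟩ := hz1
    have hk' : φ (s ^ k * a) = φ 0 := by
      rw [map_mul, map_pow, map_zero]; exact hk
    obtain ⟨⟨_, N, rfl⟩, hN⟩ := (IsLocalization.eq_iff_exists (.powers (α f)) S').mp hk'
    refine ⟨N, ?_⟩
    apply HomogeneousLocalization.val_injective
    rw [HomogeneousLocalization.val_mul, HomogeneousLocalization.val_pow, awayConst_val,
      Away.val_mk, HomogeneousLocalization.val_zero, ← map_pow,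
      ← Localization.mk_one_eq_algebraMap, Localization.mk_mul, Localization.mk_eq_mk',
      IsLocalization.mk'_eq_zero_iff]
    refine ⟨⟨_, k, rfl⟩, ?_⟩
    have : (α f) ^ N * (s ^ k * a) = 0 := by simpa using hN
    calc s ^ k * (α f ^ N * a) = (α f) ^ N * (s ^ k * a) := by ring
      _ = 0 := this

/-- If `A' = A_f` and `S' = S_f`, then `Proj S'` is the base change of `Proj S` along
`Spec A' ⟶ Spec A`. -/
lemma isPullback_projMap (hα : ∀ a, α a ∈ 𝒜 0) (hα' : ∀ a, α' a ∈ ℬ 0)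
    (comm : ∀ a, φ (α a) = α' (ρ a)) (f : A) (hφ : HomogeneousIdeal.irrelevant ℬ ≤
      (HomogeneousIdeal.irrelevant 𝒜).map φ)
    (hρ : letI := ρ.toAlgebra; IsLocalization.Away f A')
    (hS : letI := φ.toRingHom.toAlgebra; IsLocalization.Away (α f) S') :
    IsPullback (Proj.map φ hφ) (projToSpec ℬ α' hα') (projToSpec 𝒜 α hα)
      (Spec.map (CommRingCat.ofHom ρ)) := by
  refine Scheme.isPullback_of_openCover _ _ _ _ (Proj.affineOpenCover 𝒜).openCover ?_
  rintro ⟨⟨m, hm⟩, ⟨s, hs⟩⟩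
  replace hs : s ∈ 𝒜 m := hs
  have hρu : IsUnit (ρ f) := by
    letI := ρ.toAlgebra
    exact IsLocalization.Away.algebraMap_isUnit f
  have hloc := awayMap_isLocalization φ ρ α α' hα hα' comm f hS hρu s hs
  have hs' : φ s ∈ ℬ m := φ.map_mem hs
  have sq1 : IsPullback (Spec.map (CommRingCat.ofHom (Away.map φ s)))
      (Proj.awayι ℬ (φ s) hs' hm) (Proj.awayι 𝒜 s hs hm) (Proj.map φ hφ) := by
    refine IsOpenImmersion.isPullback _ _ _ _ (Proj.awayι_comp_map φ hφ hm s hs) ?_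
    rw [Proj.opensRange_awayι, Proj.opensRange_awayι, Proj.map_preimage_basicOpen]
  have sq2 : IsPullback (Spec.map (CommRingCat.ofHom (Away.map φ s)))
      (Spec.map (CommRingCat.ofHom (awayConst (𝒜 := ℬ) α' hα' (φ s))))
      (Spec.map (CommRingCat.ofHom (awayConst (𝒜 := 𝒜) α hα s)))
      (Spec.map (CommRingCat.ofHom ρ)) := by
    letI := ρ.toAlgebra
    letI := (Away.map φ s).toAlgebra
    haveI : IsLocalization (.powers f) A' := hρ
    haveI : IsLocalization ((Submonoid.powers f).map (awayConst (𝒜 := 𝒜) α hα s))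
        (Away ℬ (φ s)) := by
      rw [Submonoid.map_powers]; exact hloc
    refine isPullback_SpecMap_of_isPushout _ _ _ _
      (CommRingCat.isPushout_of_isLocalization (Rₘ := A') (Sₘ := Away ℬ (φ s))
        (awayConst (𝒜 := 𝒜) α hα s) (awayConst (𝒜 := ℬ) α' hα' (φ s)) ?_ (.powers f))
    ext a : 1
    exact (awayMap_awayConst φ ρ α α' hα hα' comm s hs a).symm
  rw [← awayι_projToSpec α hα s hs hm, ← awayι_projToSpec α' hα' (φ s) hs' hm] at sq2
  refine sq2.of_iso sq1.flip.isoPullback (Iso.refl _) (Iso.refl _) (Iso.refl _) ?_ ?_ ?_ ?_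
  · simp only [Iso.refl_hom]
    exact sq1.flip.isoPullback_hom_snd.symm
  · simp only [Iso.refl_hom, Category.comp_id]
    exact (sq1.flip.isoPullback_hom_fst_assoc _).symm
  · simp only [Iso.refl_hom, Category.comp_id]
    rfl
  · simp

end ProjBaseChange

section GradedAlgebraSheaf

open Scheme Scheme.AffineZariskiSite Opposite

/-- A quasi-coherent graded `𝒪_X`-algebra, given by its sections over the affine open subschemes:
a graded `Γ(X, U)`-algebra `S(U)` for every affine open `U`, with restriction maps to the basic
open subsets such that `S(D(f)) = S(U)_f` (`NatTrans.Coequifibered`, see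
`coequifibered_iff_forall_isLocalizationAway`). -/
structure GradedAlgebraSheaf (X : Scheme.{u}) where
  algebra : X.AffineZariskiSiteᵒᵖ ⥤ CommRingCat.{u}
  unit : (toOpensFunctor X).op ⋙ X.presheaf ⟶ algebra
  coequifibered : unit.Coequifibered
  grading : ∀ U, ℕ → AddSubgroup (algebra.obj U)
  gradedRing : ∀ U, GradedRing (grading U)
  map_mem : ∀ {U V} (f : U ⟶ V) (n : ℕ) (x : algebra.obj U), x ∈ grading U n →
    (algebra.map f).hom x ∈ grading V n
  unit_mem : ∀ U (a : Γ(X, U.unop.1)), (unit.app U).hom a ∈ grading U 0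

namespace GradedAlgebraSheaf

variable {X : Scheme.{u}} (S : GradedAlgebraSheaf X)

instance (U) : GradedRing (S.grading U) := S.gradedRing U

/-- Restriction, as a graded ring homomorphism. -/
def res {U V : X.AffineZariskiSiteᵒᵖ} (f : U ⟶ V) : S.grading U →+*ᵍ S.grading V where
  toRingHom := (S.algebra.map f).hom
  map_mem h := S.map_mem f _ _ h

lemma isLocalization_res (U : X.AffineZariskiSite) (f : Γ(X, U.1)) :
    letI := (S.res (homOfLE (U.basicOpen_le f)).op).toRingHom.toAlgebra
    IsLocalization.Away ((S.unit.app (.op U)).hom f) (S.algebra.obj (.op (U.basicOpen f))) :=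
  coequifibered_iff_forall_isLocalizationAway.mp S.coequifibered U f

lemma res_unit {U V : X.AffineZariskiSiteᵒᵖ} (f : U ⟶ V) (a : Γ(X, U.unop.1)) :
    S.res f ((S.unit.app U).hom a) =
      (S.unit.app V).hom ((((toOpensFunctor X).op ⋙ X.presheaf).map f).hom a) :=
  congr($(S.unit.naturality f).hom a).symm

lemma irrelevant_le {U V : X.AffineZariskiSiteᵒᵖ} (f : U ⟶ V) :
    HomogeneousIdeal.irrelevant (S.grading V) ≤
      (HomogeneousIdeal.irrelevant (S.grading U)).map (S.res f) := by
  obtain ⟨⟨g, hg⟩⟩ := f.unop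
  obtain ⟨U⟩ := U
  obtain ⟨V⟩ := V
  obtain rfl : U.basicOpen g = V := Subtype.ext hg
  exact irrelevant_le_map (S.res f) (S.unit.app (.op U)).hom (S.unit_mem _) g
    (S.isLocalization_res U g)

lemma res_id (U : X.AffineZariskiSiteᵒᵖ) : S.res (𝟙 U) = .id _ := by
  ext x
  exact congr($(S.algebra.map_id U).hom x)

lemma res_comp {U V W : X.AffineZariskiSiteᵒᵖ} (f : U ⟶ V) (g : V ⟶ W) :
    S.res (f ≫ g) = (S.res g).comp (S.res f) := by
  ext x
  exact congr($(S.algebra.map_comp f g).hom x)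

lemma projMap_congr {U V : X.AffineZariskiSiteᵒᵖ} {f g : S.grading U →+*ᵍ S.grading V}
    (h : f = g) (hf : HomogeneousIdeal.irrelevant (S.grading V) ≤
      (HomogeneousIdeal.irrelevant (S.grading U)).map f)
    (hg : HomogeneousIdeal.irrelevant (S.grading V) ≤
      (HomogeneousIdeal.irrelevant (S.grading U)).map g) : Proj.map f hf = Proj.map g hg := by
  subst h; rfl

/-- The structure morphism `Proj S(U) ⟶ U`. -/
def projLocal (U : X.AffineZariskiSite) : Proj (S.grading (.op U)) ⟶ U.1 :=
  projToSpec (S.grading (.op U)) (S.unit.app (.op U)).hom (S.unit_mem _) ≫ U.2.isoSpec.inv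

lemma isPullback_isoSpec_inv {U V : X.AffineZariskiSite} (f : V ⟶ U) :
    IsPullback (Spec.map (X.presheaf.map (homOfLE (toOpens_mono f.le)).op)) V.2.isoSpec.inv
      U.2.isoSpec.inv (X.homOfLE (toOpens_mono f.le)) := by
  refine IsPullback.of_vert_isIso ⟨?_⟩
  rw [Iso.eq_inv_comp, ← Category.assoc, Iso.comp_inv_eq]
  exact (Scheme.Opens.toSpecΓ_SpecMap_presheaf_map ..)

lemma isPullback_projLocal {U V : X.AffineZariskiSite} (f : V ⟶ U) :
    IsPullback (Proj.map (S.res f.op) (S.irrelevant_le f.op)) (S.projLocal V) (S.projLocal U)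
      (X.homOfLE (toOpens_mono f.le)) := by
  obtain ⟨g, hg⟩ := f.le
  obtain rfl : U.basicOpen g = V := Subtype.ext hg
  have h := isPullback_projMap (S.res f.op)
    (X.presheaf.map (homOfLE (X.basicOpen_le g)).op).hom
    (S.unit.app (.op U)).hom (S.unit.app (.op (U.basicOpen g))).hom (S.unit_mem _)
    (S.unit_mem (.op (U.basicOpen g)))
    (fun a => S.res_unit f.op a) g (S.irrelevant_le f.op)
    (U.2.isLocalization_basicOpen g) (S.isLocalization_res U g)
  exact h.paste_vert (isPullback_isoSpec_inv f)

/-- The gluing data for the relative homogeneous spectrum: `Proj S(U)` over every affine open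
`U`. -/
def projGluingData : (directedCover X).RelativeGluingData where
  functor :=
    { obj := fun U => Proj (S.grading (.op U))
      map := fun {V U} f => Proj.map (S.res f.op) (S.irrelevant_le f.op)
      map_id := fun U => by
        rw [← Proj.map_id]
        exact projMap_congr S (S.res_id _) _ _
      map_comp := fun {U V W} f g => by
        rw [← Proj.map_comp]
        exact projMap_congr S (S.res_comp _ _) _ _ }
  natTrans :=
    { app := fun U => S.projLocal U
      naturality := fun {V U} f => (S.isPullback_projLocal f).w }
  equifibered := fun {V U} f => (S.isPullback_projLocal f)

instance : (S.projGluingData.functor ⋙ Scheme.forget).IsLocallyDirected :=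
  Cover.RelativeGluingData.instIsLocallyDirectedI₀CompFunctorForgetOfIsThin ..

/-- The relative homogeneous spectrum `Proj S` of a quasi-coherent graded `𝒪_X`-algebra. -/
def relativeProj : Scheme.{u} := S.projGluingData.glued

/-- The structure morphism `Proj S ⟶ X`. -/
def relativeProjToBase : S.relativeProj ⟶ X := S.projGluingData.toBase

end GradedAlgebraSheaf

end GradedAlgebraSheaf

section BlowupAlgebra

open Polynomial

variable {R R' A A' : Type*} [CommRing R] [CommRing R'] [CommRing A] [CommRing A']

/-- Let `π : R → A` be surjective with kernel `K`, let `I` be an ideal of `A` and let `J` be its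
preimage in `R`. This is the homogeneous ideal `⨁ K J^(n-1)` of the Rees algebra `⨁ J^n` of `J`;
in degree `0` it is `K` (here `0 - 1 = 0`). -/
def blowupIdeal (π : R →+* A) (I : Ideal A) : Ideal (reesAlgebra (I.comap π)) where
  carrier := {p | ∀ n, p.1.coeff n ∈ RingHom.ker π * (I.comap π) ^ (n - 1)}
  add_mem' ha hb n := by
    simpa using add_mem (ha n) (hb n)
  zero_mem' n := by simp
  smul_mem' q p hp n := by
    simp only [smul_eq_mul, MulMemClass.coe_mul, Polynomial.coeff_mul]
    refine sum_mem ?_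
    rintro ⟨i, j⟩ hij
    have hij' : i + j = n := Finset.HasAntidiagonal.mem_antidiagonal.mp hij
    have h1 := Ideal.mul_mem_mul (q.2 i) (hp j)
    have h2 : (I.comap π) ^ i * (RingHom.ker π * (I.comap π) ^ (j - 1)) ≤
        RingHom.ker π * (I.comap π) ^ (n - 1) := by
      rw [mul_left_comm, ← pow_add]
      exact Ideal.mul_mono_right (Ideal.pow_le_pow_right (by omega))
    exact h2 h1

/-- The blow-up algebra `⨁ J^n / K J^(n-1)` of `Spec A` along the closed subscheme `V(I)` which
corresponds to the closed embedding `Spec A ⊆ Spec R` given by `π`. For `π = id` it is the Rees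
algebra of `I`. -/
def BlowupAlgebra (π : R →+* A) (I : Ideal A) : Type _ :=
  reesAlgebra (I.comap π) ⧸ blowupIdeal π I

instance (π : R →+* A) (I : Ideal A) : CommRing (BlowupAlgebra π I) :=
  inferInstanceAs (CommRing (reesAlgebra (I.comap π) ⧸ blowupIdeal π I))

/-- The quotient map from the Rees algebra of `J`. -/
def BlowupAlgebra.mk (π : R →+* A) (I : Ideal A) :
    reesAlgebra (I.comap π) →+* BlowupAlgebra π I :=
  Ideal.Quotient.mk (blowupIdeal π I)

lemma BlowupAlgebra.mk_surjective (π : R →+* A) (I : Ideal A) :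
    Function.Surjective (BlowupAlgebra.mk π I) :=
  Ideal.Quotient.mk_surjective

lemma BlowupAlgebra.mk_eq_zero {π : R →+* A} {I : Ideal A} {p : reesAlgebra (I.comap π)} :
    BlowupAlgebra.mk π I p = 0 ↔
      ∀ n, p.1.coeff n ∈ RingHom.ker π * (I.comap π) ^ (n - 1) :=
  Ideal.Quotient.eq_zero_iff_mem

/-- The class of `r t^n`, where `r ∈ J^n`. -/
def BlowupAlgebra.mon (π : R →+* A) (I : Ideal A) (n : ℕ) (r : R) (hr : r ∈ (I.comap π) ^ n) :
    BlowupAlgebra π I :=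
  BlowupAlgebra.mk π I ⟨monomial n r, reesAlgebra.monomial_mem.mpr hr⟩

lemma BlowupAlgebra.mon_eq_zero {π : R →+* A} {I : Ideal A} {n : ℕ} {r : R}
    {hr : r ∈ (I.comap π) ^ n} (h : r ∈ RingHom.ker π * (I.comap π) ^ (n - 1)) :
    BlowupAlgebra.mon π I n r hr = 0 := by
  refine BlowupAlgebra.mk_eq_zero.mpr fun m => ?_
  simp only [coeff_monomial]
  split_ifs with hm
  · exact hm ▸ h
  · exact zero_mem _

lemma BlowupAlgebra.mon_add {π : R →+* A} {I : Ideal A} {n : ℕ} {r s : R}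
    (hr : r ∈ (I.comap π) ^ n) (hs : s ∈ (I.comap π) ^ n) :
    BlowupAlgebra.mon π I n (r + s) (add_mem hr hs) =
      BlowupAlgebra.mon π I n r hr + BlowupAlgebra.mon π I n s hs := by
  rw [mon, mon, mon, ← map_add]
  congr 1
  exact Subtype.ext (map_add (monomial n) r s)

lemma BlowupAlgebra.mon_mul {π : R →+* A} {I : Ideal A} {n m : ℕ} {r s : R}
    (hr : r ∈ (I.comap π) ^ n) (hs : s ∈ (I.comap π) ^ m) (hrs : r * s ∈ (I.comap π) ^ (n + m)) :
    BlowupAlgebra.mon π I n r hr * BlowupAlgebra.mon π I m s hs =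
      BlowupAlgebra.mon π I (n + m) (r * s) hrs := by
  rw [mon, mon, mon, ← map_mul]
  congr 1
  exact Subtype.ext (monomial_mul_monomial n m r s)

lemma BlowupAlgebra.mon_congr {π : R →+* A} {I : Ideal A} {n : ℕ} {r s : R}
    (hr : r ∈ (I.comap π) ^ n) (hs : s ∈ (I.comap π) ^ n)
    (h : r - s ∈ RingHom.ker π * (I.comap π) ^ (n - 1)) :
    BlowupAlgebra.mon π I n r hr = BlowupAlgebra.mon π I n s hs := by
  have := BlowupAlgebra.mon_add hs (sub_mem hr hs)
  rw [BlowupAlgebra.mon_eq_zero h, add_zero] at this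
  rw [← this]
  congr 1
  ring

/-- The structure of an `A`-algebra on the blow-up algebra. -/
def blowupUnit (π : R →+* A) (hπ : Function.Surjective π) (I : Ideal A) :
    A →+* BlowupAlgebra π I :=
  π.liftOfSurjective hπ ⟨(BlowupAlgebra.mk π I).comp (algebraMap R _), by
    intro r hr
    rw [RingHom.mem_ker, RingHom.comp_apply]
    have h := BlowupAlgebra.mon_eq_zero (π := π) (I := I) (n := 0) (r := r) (hr := by simp)
      (by simpa using hr)
    exact h⟩

lemma blowupUnit_apply (π : R →+* A) (hπ : Function.Surjective π) (I : Ideal A) (r : R) :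
    blowupUnit π hπ I (π r) = BlowupAlgebra.mon π I 0 r (by simp) :=
  RingHom.liftOfRightInverse_comp_apply _ _ _ _ _

/-- The identification of `I` with the degree one part `J / K` of the blow-up algebra. -/
def blowupOne (π : R →+* A) (hπ : Function.Surjective π) (I : Ideal A) :
    I →+ BlowupAlgebra π I :=
  AddMonoidHom.mk' (fun x => BlowupAlgebra.mon π I 1 (Function.surjInv hπ x) (by
      simp [Function.surjInv_eq hπ])) (by
    intro x y
    rw [← BlowupAlgebra.mon_add]
    refine BlowupAlgebra.mon_congr _ _ ?_
    simp [RingHom.mem_ker, Function.surjInv_eq hπ])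

/-- The canonical homomorphism of graded `A`-algebras from the symmetric algebra of `I` to the
blow-up algebra which is the identification `I = J / K` in degree one. -/
def toBlowup (π : R →+* A) (hπ : Function.Surjective π) (I : Ideal A) :
    SymmetricAlgebra A I →+* BlowupAlgebra π I :=
  symLift (A := A) (M := I) (blowupUnit π hπ I) (blowupOne π hπ I) (by
    intro a x
    obtain ⟨r, rfl⟩ := hπ a
    rw [blowupUnit_apply]
    simp only [blowupOne, AddMonoidHom.mk'_apply]
    have hrx : r * Function.surjInv hπ x ∈ (I.comap π) ^ (0 + 1) := by
      simpa [Function.surjInv_eq hπ] using I.mul_mem_left (π r) x.2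
    rw [BlowupAlgebra.mon_mul _ _ hrx]
    refine BlowupAlgebra.mon_congr (n := 1) _ (by simpa using hrx) ?_
    simp [RingHom.mem_ker, Function.surjInv_eq hπ])

variable (π : R →+* A) (hπ : Function.Surjective π) (I : Ideal A)

lemma toBlowup_algebraMap (r : R) :
    toBlowup π hπ I (algebraMap A _ (π r)) = BlowupAlgebra.mon π I 0 r (by simp) :=
  (symLift_algebraMap (A := A) (M := I) _ _ _ _).trans (blowupUnit_apply π hπ I r)

lemma toBlowup_ι (r : R) (hr : π r ∈ I) :
    toBlowup π hπ I (SymmetricAlgebra.ι A I ⟨π r, hr⟩) =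
      BlowupAlgebra.mon π I 1 r (by simpa using hr) := by
  refine (symLift_ι (A := A) (M := I) _ _ _ _).trans ?_
  refine BlowupAlgebra.mon_congr (by simpa [Function.surjInv_eq hπ] using hr) _ ?_
  simp [RingHom.mem_ker, Function.surjInv_eq hπ]

lemma toBlowup_homogeneous {n : ℕ} {x : SymmetricAlgebra A I} (hx : x ∈ symGrading A I n) :
    ∃ (r : R) (hr : r ∈ (I.comap π) ^ n), toBlowup π hπ I x = BlowupAlgebra.mon π I n r hr := by
  induction hx using Submodule.pow_induction_on_left' with
  | algebraMap a =>
    obtain ⟨r, rfl⟩ := hπ a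
    exact ⟨r, _, toBlowup_algebraMap π hπ I r⟩
  | add x y i hx hy ihx ihy =>
    obtain ⟨r, hr, h⟩ := ihx
    obtain ⟨s, hs, h'⟩ := ihy
    exact ⟨r + s, add_mem hr hs, by rw [map_add, h, h', BlowupAlgebra.mon_add]⟩
  | mem_mul m hm i x hx ih =>
    obtain ⟨⟨m, hm⟩, rfl⟩ := hm
    obtain ⟨r, rfl⟩ := hπ m
    obtain ⟨s, hs, h'⟩ := ih
    have hr : r ∈ (I.comap π) ^ 1 := by simpa using hm
    have hrs : r * s ∈ (I.comap π) ^ (1 + i) := by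
      rw [pow_add]; exact Ideal.mul_mem_mul hr hs
    have key : toBlowup π hπ I (SymmetricAlgebra.ι A I ⟨π r, hm⟩ * x) =
        BlowupAlgebra.mon π I (1 + i) (r * s) hrs := by
      rw [map_mul, h', toBlowup_ι, BlowupAlgebra.mon_mul]
    rw [Nat.succ_eq_add_one, add_comm]
    exact ⟨r * s, hrs, key⟩

/-- The blow-up algebras are graded quotients of the symmetric algebra. -/
lemma ker_toBlowup_isHomogeneous :
    (RingHom.ker (toBlowup π hπ I)).IsHomogeneous (symGrading A I) := by
  classical
  intro i x hx
  have hch : ∀ n, ∃ (r : R) (hr : r ∈ (I.comap π) ^ n), toBlowup π hπ I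
      (DirectSum.decompose (symGrading A I) x n) = BlowupAlgebra.mon π I n r hr :=
    fun n => toBlowup_homogeneous π hπ I (SetLike.coe_mem _)
  choose r hr h using hch
  rw [RingHom.mem_ker] at hx ⊢
  rw [← DirectSum.sum_support_decompose (symGrading A I) x, map_sum] at hx
  simp only [h] at hx
  simp only [BlowupAlgebra.mon, ← map_sum] at hx
  rw [BlowupAlgebra.mk_eq_zero] at hx
  have hc := hx i
  by_cases hi : i ∈ (DirectSum.decompose (symGrading A I) x).support
  · rw [h i]
    refine BlowupAlgebra.mon_eq_zero ?_
    simpa [Polynomial.finsetSum_coeff, coeff_monomial, hi] using hc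
  · rw [DFinsupp.notMem_support_iff.mp hi]
    simp

lemma toBlowup_surjective : Function.Surjective (toBlowup π hπ I) := by
  intro b
  obtain ⟨⟨p, hp⟩, rfl⟩ := BlowupAlgebra.mk_surjective π I b
  suffices H : ∀ p (_ : p ∈ Algebra.adjoin R
      (Submodule.map (monomial 1 : R →ₗ[R] R[X]) (I.comap π) : Set R[X]))
      (hp : p ∈ reesAlgebra (I.comap π)), ∃ x, toBlowup π hπ I x = BlowupAlgebra.mk π I ⟨p, hp⟩ from
    H p (by rw [adjoin_monomial_eq_reesAlgebra]; exact hp) hp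
  intro p h
  have hle := (adjoin_monomial_eq_reesAlgebra (I.comap π)).le
  induction h using Algebra.adjoin_induction with
  | mem p hp =>
    intro _
    obtain ⟨r, hr, rfl⟩ := hp
    exact ⟨_, toBlowup_ι π hπ I r hr⟩
  | algebraMap r => exact fun _ => ⟨_, toBlowup_algebraMap π hπ I r⟩
  | add p q hp hq ihp ihq =>
    intro _
    obtain ⟨x, hx⟩ := ihp (hle hp)
    obtain ⟨y, hy⟩ := ihq (hle hq)
    exact ⟨x + y, by rw [map_add, hx, hy, ← map_add]; rfl⟩
  | mul p q hp hq ihp ihq =>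
    intro _
    obtain ⟨x, hx⟩ := ihp (hle hp)
    obtain ⟨y, hy⟩ := ihq (hle hq)
    exact ⟨x * y, by rw [map_mul, hx, hy, ← map_mul]; rfl⟩

variable (π' : R' →+* A') (hπ' : Function.Surjective π') (I' : Ideal A') (θ : R →+* R')
  (ρ : A →+* A')

/-- A commutative square of rings induces a homomorphism of Rees algebras. -/
def reesMap (hθ : π'.comp θ = ρ.comp π) (hI : I ≤ I'.comap ρ) :
    reesAlgebra (I.comap π) →+* reesAlgebra (I'.comap π') :=
  ((Polynomial.mapRingHom θ).comp (reesAlgebra (I.comap π)).val.toRingHom).codRestrict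
    (reesAlgebra (I'.comap π')).toSubring (by
    intro p n
    change (p.1.map θ).coeff n ∈ _
    rw [Polynomial.coeff_map]
    have h1 : (I.comap π).map θ ≤ I'.comap π' := by
      rw [Ideal.map_le_iff_le_comap, Ideal.comap_comap, hθ, ← Ideal.comap_comap]
      exact Ideal.comap_mono hI
    have h2 := Ideal.mem_map_of_mem θ (p.2 n)
    rw [Ideal.map_pow] at h2
    exact Ideal.pow_right_mono h1 n h2)

/-- Functoriality of the blow-up algebra. -/
def blowupMap (hθ : π'.comp θ = ρ.comp π) (hI : I ≤ I'.comap ρ) :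
    BlowupAlgebra π I →+* BlowupAlgebra π' I' :=
  Ideal.quotientMap (blowupIdeal π' I') (reesMap π I π' I' θ ρ hθ hI) (by
    intro p hp n
    change (p.1.map θ).coeff n ∈ _
    rw [Polynomial.coeff_map]
    have h1 : (I.comap π).map θ ≤ I'.comap π' := by
      rw [Ideal.map_le_iff_le_comap, Ideal.comap_comap, hθ, ← Ideal.comap_comap]
      exact Ideal.comap_mono hI
    have h0 : (RingHom.ker π).map θ ≤ RingHom.ker π' := by
      rw [Ideal.map_le_iff_le_comap]
      intro r hr
      have := congr($hθ r)
      simp only [RingHom.comp_apply] at this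
      rw [Ideal.mem_comap, RingHom.mem_ker, this, (RingHom.mem_ker.mp hr), map_zero]
    have h2 := Ideal.mem_map_of_mem θ (hp n)
    rw [Ideal.map_mul, Ideal.map_pow] at h2
    exact Ideal.mul_mono h0 (Ideal.pow_right_mono h1 _) h2)

lemma blowupMap_mk (hθ : π'.comp θ = ρ.comp π) (hI : I ≤ I'.comap ρ)
    (p : reesAlgebra (I.comap π)) :
    blowupMap π I π' I' θ ρ hθ hI (BlowupAlgebra.mk π I p) =
      BlowupAlgebra.mk π' I' (reesMap π I π' I' θ ρ hθ hI p) := rfl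

/-- The restriction of a ring homomorphism to ideals, as a semilinear map. -/
def idealRes (hI : I ≤ I'.comap ρ) : I →ₛₗ[ρ] I' where
  toFun x := ⟨ρ x, hI x.2⟩
  map_add' x y := Subtype.ext (by simp)
  map_smul' a x := Subtype.ext (by simp)

lemma blowupMap_mon (hθ : π'.comp θ = ρ.comp π) (hI : I ≤ I'.comap ρ) (n : ℕ) (r : R)
    (hr : r ∈ (I.comap π) ^ n) (hr' : θ r ∈ (I'.comap π') ^ n) :
    blowupMap π I π' I' θ ρ hθ hI (BlowupAlgebra.mon π I n r hr) =
      BlowupAlgebra.mon π' I' n (θ r) hr' := by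
  refine (Ideal.quotientMap_mk ..).trans ?_
  refine congrArg (BlowupAlgebra.mk π' I') ?_
  exact Subtype.ext (Polynomial.map_monomial θ)

lemma blowupMap_toBlowup (hθ : π'.comp θ = ρ.comp π) (hI : I ≤ I'.comap ρ)
    (x : SymmetricAlgebra A I) :
    blowupMap π I π' I' θ ρ hθ hI (toBlowup π hπ I x) =
      toBlowup π' hπ' I' (symMap ρ (idealRes I I' ρ hI) x) := by
  suffices h : (blowupMap π I π' I' θ ρ hθ hI).comp (toBlowup π hπ I) =
      (toBlowup π' hπ' I').comp (symMap ρ (idealRes I I' ρ hI)) from congr($h x)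
  have hθr : ∀ r, π' (θ r) = ρ (π r) := fun r => congr($hθ r)
  apply sym_ringHom_ext (A := A) (M := I)
  · intro a
    obtain ⟨r, rfl⟩ := hπ a
    rw [RingHom.comp_apply, RingHom.comp_apply, toBlowup_algebraMap, symMap_algebraMap,
      ← hθr, toBlowup_algebraMap, blowupMap_mon]
  · rintro ⟨m, hm⟩
    obtain ⟨r, rfl⟩ := hπ m
    have hm' : π' (θ r) ∈ I' := by rw [hθr]; exact hI hm
    have : idealRes I I' ρ hI ⟨π r, hm⟩ = ⟨π' (θ r), hm'⟩ := Subtype.ext (hθr r).symm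
    rw [RingHom.comp_apply, RingHom.comp_apply, toBlowup_ι, symMap_ι, this, toBlowup_ι,
      blowupMap_mon]

end BlowupAlgebra

section QuasiSym

variable {k A A' : Type u} [CommRing k] [CommRing A] [CommRing A']

/-- A closed embedding over `k` of `Spec A` in an ambient affine `k`-scheme `Spec R` (not
necessarily nonsingular), that is, a surjective homomorphism of `k`-algebras `R → A`. The
`k`-algebra structure of `A` is given by `φ`. -/
structure Ambient (φ : k →+* A) where
  ring : Type u
  [commRing : CommRing ring]
  str : k →+* ring
  proj : ring →+* A
  surjective : Function.Surjective proj
  comm : proj.comp str = φ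

attribute [instance] Ambient.commRing

/-- A morphism of ambient schemes, compatible with the embeddings of `Spec A`; in terms of rings,
a homomorphism of `k`-algebras over `A`. -/
structure Ambient.Hom {φ : k →+* A} (R R' : Ambient φ) where
  hom : R.ring →+* R'.ring
  str_comm : hom.comp R.str = R'.str
  proj_comm : R'.proj.comp hom = R.proj

variable (φ : k →+* A) (I : Ideal A)

/-- The blow-up algebra of `Spec A` along `V(I)` corresponding to an ambient scheme. -/
abbrev Ambient.algebra {φ : k →+* A} (R : Ambient φ) (I : Ideal A) : Type u :=
  BlowupAlgebra R.proj I

/-- The homomorphism of blow-up algebras induced by a morphism of ambient schemes. -/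
def Ambient.Hom.map {φ : k →+* A} {R R' : Ambient φ} (θ : R.Hom R') (I : Ideal A) :
    R.algebra I →+* R'.algebra I :=
  blowupMap R.proj I R'.proj I θ.hom (RingHom.id A) (by rw [θ.proj_comm]; rfl) le_rfl

/-- The elements of the symmetric algebra of `I` that vanish in the blow-up algebras corresponding
to all ambient schemes. -/
def quasiSymIdeal : Ideal (SymmetricAlgebra A I) :=
  ⨅ R : Ambient φ, RingHom.ker (toBlowup R.proj R.surjective I)

/-- The quasi-symmetric algebra of `I`: the inverse limit of the system of the blow-up algebras
`⨁ J^n / K J^(n-1)` of `Spec A` along `V(I)` corresponding to all closed embeddings of `Spec A`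
in an ambient scheme. All of them are quotients of the symmetric algebra, and the inverse limit is
the quotient by the intersection of the kernels; see `quasiSym_isLimit` for its universal
property. -/
def QuasiSym : Type u := SymmetricAlgebra A I ⧸ quasiSymIdeal φ I

instance : CommRing (QuasiSym φ I) :=
  inferInstanceAs (CommRing (SymmetricAlgebra A I ⧸ quasiSymIdeal φ I))

/-- The quotient map from the symmetric algebra. -/
def QuasiSym.mk : SymmetricAlgebra A I →+* QuasiSym φ I := Ideal.Quotient.mk (quasiSymIdeal φ I)

lemma QuasiSym.mk_surjective : Function.Surjective (QuasiSym.mk φ I) :=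
  Ideal.Quotient.mk_surjective

lemma QuasiSym.mk_eq_zero {x : SymmetricAlgebra A I} :
    QuasiSym.mk φ I x = 0 ↔ x ∈ quasiSymIdeal φ I := Ideal.Quotient.eq_zero_iff_mem

lemma mem_quasiSymIdeal {x : SymmetricAlgebra A I} : x ∈ quasiSymIdeal φ I ↔
    ∀ R : Ambient φ, toBlowup R.proj R.surjective I x = 0 := by
  simp [quasiSymIdeal, RingHom.mem_ker]

/-- The projection from the inverse limit. -/
def QuasiSym.toAmbient (R : Ambient φ) : QuasiSym φ I →+* R.algebra I :=
  Ideal.Quotient.lift (quasiSymIdeal φ I) (toBlowup R.proj R.surjective I)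
    fun _ hx => (mem_quasiSymIdeal φ I).mp hx R

/-- The ambient affine space `Spec k[x_a | a ∈ A]`. -/
def Ambient.free : Ambient φ where
  ring := MvPolynomial A k
  str := MvPolynomial.C
  proj := MvPolynomial.eval₂Hom φ id
  surjective a := ⟨MvPolynomial.X a, by simp⟩
  comm := by ext; simp

/-- The ambient affine space maps to every other ambient scheme. -/
def Ambient.freeHom (R : Ambient φ) : (Ambient.free φ).Hom R where
  hom := MvPolynomial.eval₂Hom R.str (Function.surjInv R.surjective)
  str_comm := RingHom.ext fun c => MvPolynomial.eval₂Hom_C _ _ c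
  proj_comm := by
    refine MvPolynomial.ringHom_ext ?_ ?_
    · intro c
      change R.proj (MvPolynomial.eval₂Hom _ _ (MvPolynomial.C c)) =
        MvPolynomial.eval₂Hom φ id (MvPolynomial.C c)
      rw [MvPolynomial.eval₂Hom_C, MvPolynomial.eval₂Hom_C]
      exact congr($(R.comm) c)
    · intro a
      change R.proj (MvPolynomial.eval₂Hom _ _ (MvPolynomial.X a)) =
        MvPolynomial.eval₂Hom φ id (MvPolynomial.X a)
      rw [MvPolynomial.eval₂Hom_X', MvPolynomial.eval₂Hom_X', Function.surjInv_eq R.surjective]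
      rfl

lemma symMap_id (x : SymmetricAlgebra A I) :
    symMap (RingHom.id A) (idealRes I I (RingHom.id A) le_rfl) x = x := by
  have : symMap (RingHom.id A) (idealRes I I (RingHom.id A) le_rfl) =
      RingHom.id (SymmetricAlgebra A I) := by
    apply sym_ringHom_ext
    · intro a; simp
    · intro m; rw [symMap_ι]; rfl
  exact congr($this x)

lemma Ambient.Hom.map_toBlowup {R R' : Ambient φ} (θ : R.Hom R') (x : SymmetricAlgebra A I) :
    θ.map I (toBlowup R.proj R.surjective I x) = toBlowup R'.proj R'.surjective I x := by
  refine (blowupMap_toBlowup R.proj R.surjective I R'.proj R'.surjective I θ.hom (RingHom.id A)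
    _ _ x).trans ?_
  rw [symMap_id]

lemma mem_quasiSymIdeal_iff_free {x : SymmetricAlgebra A I} : x ∈ quasiSymIdeal φ I ↔
    toBlowup (Ambient.free φ).proj (Ambient.free φ).surjective I x = 0 := by
  rw [mem_quasiSymIdeal]
  refine ⟨fun h => h _, fun h R => ?_⟩
  rw [← (Ambient.freeHom φ R).map_toBlowup, h, map_zero]

/-- The quasi-symmetric algebra is the inverse limit of the blow-up algebras corresponding to all
ambient schemes: an element is the same as a family of elements of the blow-up algebras which is
compatible with all morphisms of ambient schemes. -/
theorem quasiSym_isLimit (b : ∀ R : Ambient φ, R.algebra I)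
    (hb : ∀ (R R' : Ambient φ) (θ : R.Hom R'), θ.map I (b R) = b R') :
    ∃! q : QuasiSym φ I, ∀ R, QuasiSym.toAmbient φ I R q = b R := by
  obtain ⟨x, hx⟩ := toBlowup_surjective (Ambient.free φ).proj (Ambient.free φ).surjective I
    (b (Ambient.free φ))
  refine ⟨QuasiSym.mk φ I x, fun R => ?_, ?_⟩
  · change toBlowup R.proj R.surjective I x = b R
    rw [← (Ambient.freeHom φ R).map_toBlowup, hx, hb]
  · intro q hq
    obtain ⟨y, rfl⟩ := QuasiSym.mk_surjective φ I q
    rw [← sub_eq_zero, ← map_sub, QuasiSym.mk_eq_zero, mem_quasiSymIdeal_iff_free, map_sub,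
      sub_eq_zero, hx]
    exact hq (Ambient.free φ)

lemma QuasiSym.toAmbient_map {R R' : Ambient φ} (θ : R.Hom R') (q : QuasiSym φ I) :
    θ.map I (QuasiSym.toAmbient φ I R q) = QuasiSym.toAmbient φ I R' q := by
  obtain ⟨y, rfl⟩ := QuasiSym.mk_surjective φ I q
  exact θ.map_toBlowup φ I y

/-- The grading of the quasi-symmetric algebra. -/
def QuasiSym.grading (n : ℕ) : AddSubgroup (QuasiSym φ I) :=
  quotGrading (symGrading A I) (quasiSymIdeal φ I) n

lemma quasiSymIdeal_isHomogeneous : (quasiSymIdeal φ I).IsHomogeneous (symGrading A I) := by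
  intro i x hx
  rw [mem_quasiSymIdeal] at hx ⊢
  exact fun R => ker_toBlowup_isHomogeneous R.proj R.surjective I i (hx R)

instance : GradedRing (QuasiSym.grading φ I) :=
  quotGradedRing (quasiSymIdeal_isHomogeneous φ I)

variable (φ' : k →+* A') (I' : Ideal A') (ρ : A →+* A')

lemma quasiSymIdeal_le_comap (hρ : ρ.comp φ = φ') (hI : I ≤ I'.comap ρ) :
    quasiSymIdeal φ I ≤ (quasiSymIdeal φ' I').comap (symMap ρ (idealRes I I' ρ hI)) := by
  intro x hx
  rw [Ideal.mem_comap, mem_quasiSymIdeal]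
  intro R'
  let F : Ambient φ :=
    { ring := RingHom.eqLocus (R'.proj.comp (RingHom.fst R'.ring A)) (ρ.comp (RingHom.snd R'.ring A))
      str := (R'.str.prod φ).codRestrict _ (by
        intro c
        have := congr($(R'.comm) c)
        have h2 := congr($hρ c)
        simp only [RingHom.comp_apply] at this h2
        change R'.proj (R'.str c) = ρ (φ c)
        rw [this, h2])
      proj := (RingHom.snd R'.ring A).comp (Subring.subtype _)
      surjective := by
        intro a
        obtain ⟨r, hr⟩ := R'.surjective (ρ a)
        exact ⟨⟨(r, a), hr⟩, rfl⟩
      comm := rfl }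
  have h := (mem_quasiSymIdeal φ I).mp hx F
  rw [← blowupMap_toBlowup F.proj F.surjective I R'.proj R'.surjective I'
    ((RingHom.fst R'.ring A).comp (Subring.subtype _)) ρ (by ext ⟨p, hp⟩; exact hp) hI, h, map_zero]

/-- Functoriality of the quasi-symmetric algebra. -/
def quasiSymMap (hρ : ρ.comp φ = φ') (hI : I ≤ I'.comap ρ) : QuasiSym φ I →+* QuasiSym φ' I' :=
  Ideal.quotientMap (quasiSymIdeal φ' I') (symMap ρ (idealRes I I' ρ hI))
    (quasiSymIdeal_le_comap φ I φ' I' ρ hρ hI)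

lemma quasiSymMap_mk (hρ : ρ.comp φ = φ') (hI : I ≤ I'.comap ρ) (x : SymmetricAlgebra A I) :
    quasiSymMap φ I φ' I' ρ hρ hI (QuasiSym.mk φ I x) =
      QuasiSym.mk φ' I' (symMap ρ (idealRes I I' ρ hI) x) :=
  Ideal.quotientMap_mk ..

end QuasiSym

section Localization

variable {k A A' : Type u} [CommRing k] [CommRing A] [CommRing A']

lemma idealRes_surj (I : Ideal A) (ρ : A →+* A') (f : A)
    (hloc : letI := ρ.toAlgebra; IsLocalization.Away f A') (I' : Ideal A') (hI' : I.map ρ = I')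
    (hI : I ≤ I'.comap ρ) (y : I') : ∃ (n : ℕ) (x : I), ρ f ^ n • y = idealRes I I' ρ hI x := by
  letI := ρ.toAlgebra
  obtain ⟨y, hy⟩ := y
  subst hI'
  obtain ⟨⟨x, ⟨_, n, rfl⟩⟩, h⟩ :=
    (IsLocalization.mem_map_algebraMap_iff (.powers f) A').mp hy
  refine ⟨n, x, Subtype.ext ?_⟩
  change ρ f ^ n * y = ρ x
  rw [mul_comm, ← map_pow]
  exact h

lemma idealRes_inj (I : Ideal A) (ρ : A →+* A') (f : A)
    (hloc : letI := ρ.toAlgebra; IsLocalization.Away f A') (I' : Ideal A')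
    (hI : I ≤ I'.comap ρ) (x y : I) (h : idealRes I I' ρ hI x = idealRes I I' ρ hI y) :
    ∃ n : ℕ, f ^ n • x = f ^ n • y := by
  letI := ρ.toAlgebra
  obtain ⟨⟨_, n, rfl⟩, hn⟩ := (IsLocalization.eq_iff_exists (.powers f) A').mp
    (congrArg Subtype.val h)
  exact ⟨n, Subtype.ext hn⟩

lemma isLocalizationAway_toAlgebra [Algebra A A'] (f : A) [h : IsLocalization.Away f A'] :
    letI := (algebraMap A A').toAlgebra
    IsLocalization.Away f A' := by
  have h1 := h.map_units
  have h2 := IsLocalization.surj (S := A') (.powers f)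
  have h3 := fun x y => IsLocalization.exists_of_eq (S := A') (M := .powers f) (x := x) (y := y)
  letI := (algebraMap A A').toAlgebra
  exact ⟨h1, h2, h3 _ _⟩

lemma blowupMap_eq_zero {R R' : Type u} [CommRing R] [CommRing R'] (π : R →+* A) (π' : R' →+* A')
    (I : Ideal A) (I' : Ideal A') (θ : R →+* R') (ρ : A →+* A') (hθ : π'.comp θ = ρ.comp π)
    (hI : I ≤ I'.comap ρ) (F : R)
    (hlocR : letI := θ.toAlgebra; IsLocalization.Away F R')
    (hloc : letI := ρ.toAlgebra; IsLocalization.Away (π F) A') (hI' : I.map ρ = I')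
    (b : BlowupAlgebra π I) (hb : blowupMap π I π' I' θ ρ hθ hI b = 0) :
    ∃ N : ℕ, BlowupAlgebra.mon π I 0 F (by simp) ^ N * b = 0 := by
  letI := ρ.toAlgebra
  letI := θ.toAlgebra
  have hπ' : ∀ r, π' (θ r) = ρ (π r) := fun r => congr($hθ r)
  have hle : ∀ (L : Ideal A), (L.map ρ).comap π' ≤ (L.comap π).map θ := by
    intro L y hy
    rw [Ideal.mem_comap] at hy
    obtain ⟨n, r, h⟩ := IsLocalization.Away.surj F y
    change y * θ F ^ n = θ r at h
    have h1 : ρ (π r) ∈ L.map ρ := by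
      rw [← hπ', ← h, map_mul]; exact Ideal.mul_mem_right _ _ hy
    obtain ⟨_, ⟨m, rfl⟩, hm⟩ :=
      (IsLocalization.algebraMap_mem_map_algebraMap_iff (.powers (π F)) A' L _).mp h1
    refine (IsLocalization.mem_map_algebraMap_iff (.powers F) R').mpr ?_
    refine ⟨⟨⟨F ^ m * r, ?_⟩, ⟨F ^ (m + n), m + n, rfl⟩⟩, ?_⟩
    · rw [Ideal.mem_comap, map_mul, map_pow]; exact hm
    · change y * θ (F ^ (m + n)) = θ (F ^ m * r)
      rw [map_mul, map_pow, map_pow, ← h]; ring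
  obtain ⟨p, rfl⟩ := BlowupAlgebra.mk_surjective π I b
  rw [blowupMap_mk] at hb
  have h1 : ∀ n, ∃ m : ℕ, F ^ m * p.1.coeff n ∈ RingHom.ker π * (I.comap π) ^ (n - 1) := by
    intro n
    have h2 : (p.1.map θ).coeff n ∈ RingHom.ker π' * (I'.comap π') ^ (n - 1) :=
      BlowupAlgebra.mk_eq_zero.mp hb n
    rw [Polynomial.coeff_map] at h2
    have hK : RingHom.ker π' ≤ (RingHom.ker π).map θ := by
      have := hle ⊥
      rwa [Ideal.map_bot] at this
    have hJ := hle I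
    rw [hI'] at hJ
    have h3 := Ideal.mul_mono hK (Ideal.pow_right_mono hJ (n - 1)) h2
    rw [← Ideal.map_pow, ← Ideal.map_mul] at h3
    obtain ⟨_, ⟨m, rfl⟩, hm⟩ :=
      (IsLocalization.algebraMap_mem_map_algebraMap_iff (.powers F) R' _ _).mp h3
    exact ⟨m, hm⟩
  choose m hm using h1
  refine ⟨p.1.support.sup m, ?_⟩
  rw [BlowupAlgebra.mon, ← map_pow, ← map_mul, BlowupAlgebra.mk_eq_zero]
  intro n
  have hcoeff : ∀ N : ℕ, ((⟨Polynomial.monomial 0 F, reesAlgebra.monomial_mem.mpr (by simp)⟩ :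
      reesAlgebra (I.comap π)) ^ N * p).1.coeff n = F ^ N * p.1.coeff n := by
    intro N
    change ((Polynomial.monomial 0 F) ^ N * p.1).coeff n = _
    rw [Polynomial.monomial_zero_left, ← Polynomial.C_pow, Polynomial.coeff_C_mul]
  rw [hcoeff]
  by_cases hn : n ∈ p.1.support
  · have : F ^ (p.1.support.sup m) = F ^ (p.1.support.sup m - m n) * F ^ (m n) := by
      rw [← pow_add, Nat.sub_add_cancel (Finset.le_sup hn)]
    rw [this, mul_assoc]
    exact Ideal.mul_mem_left _ _ (hm n)
  · rw [Polynomial.notMem_support_iff.mp hn, mul_zero]; exact zero_mem _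

variable (φ : k →+* A) (I : Ideal A) (φ' : k →+* A') (I' : Ideal A') (ρ : A →+* A')

lemma quasiSymMap_isLocalization (hρ : ρ.comp φ = φ') (hI : I ≤ I'.comap ρ) (f : A)
    (hloc : letI := ρ.toAlgebra; IsLocalization.Away f A') (hI' : I.map ρ = I') :
    letI := (quasiSymMap φ I φ' I' ρ hρ hI).toAlgebra
    IsLocalization.Away (QuasiSym.mk φ I (algebraMap A _ f)) (QuasiSym φ' I') := by
  have hsym := symMap_isLocalization ρ (idealRes I I' ρ hI) f hloc
    (idealRes_surj I ρ f hloc I' hI' hI) (idealRes_inj I ρ f hloc I' hI)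
  have hinj : ∀ x, symMap ρ (idealRes I I' ρ hI) x ∈ quasiSymIdeal φ' I' →
      ∃ n : ℕ, algebraMap A (SymmetricAlgebra A I) f ^ n * x ∈ quasiSymIdeal φ I := by
    intro x hx
    let P := Ambient.free φ
    obtain ⟨F, hF⟩ := P.surjective f
    letI := ρ.toAlgebra
    have hu : IsUnit ((ρ.comp P.proj) F) := by
      rw [RingHom.comp_apply, hF]; exact IsLocalization.Away.algebraMap_isUnit f
    let π' : Localization.Away F →+* A' := IsLocalization.Away.lift F hu
    have hπ' : ∀ r, π' (algebraMap _ _ r) = ρ (P.proj r) := IsLocalization.Away.lift_eq F hu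
    let P' : Ambient φ' :=
      { ring := Localization.Away F
        str := (algebraMap P.ring _).comp P.str
        proj := π'
        surjective := by
          intro a
          obtain ⟨n, b, h⟩ := IsLocalization.Away.surj f a
          obtain ⟨r, rfl⟩ := P.surjective b
          let y : Submonoid.powers F := ⟨F ^ n, n, rfl⟩
          refine ⟨IsLocalization.mk' (Localization.Away F) r y, ?_⟩
          have h2 := congrArg π' (IsLocalization.mk'_spec (Localization.Away F) r y)
          rw [map_mul, hπ', hπ', map_pow, map_pow, hF] at h2
          have hu' : IsUnit (ρ f ^ n) := (IsLocalization.Away.algebraMap_isUnit f).pow n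
          exact hu'.mul_right_cancel (h2.trans h.symm)
        comm := by
          ext c
          have h1 := congr($(P.comm) c)
          have h2 := congr($hρ c)
          simp only [RingHom.comp_apply] at h1 h2 ⊢
          rw [hπ', h1, h2] }
    have h0 := (mem_quasiSymIdeal φ' I').mp hx P'
    rw [← blowupMap_toBlowup P.proj P.surjective I P'.proj P'.surjective I'
      (algebraMap P.ring (Localization.Away F)) ρ (by ext c; exact hπ' c) hI] at h0
    obtain ⟨N, hN⟩ := blowupMap_eq_zero P.proj P'.proj I I'
      (algebraMap P.ring (Localization.Away F)) ρ (by ext c; exact hπ' c) hI F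
      (isLocalizationAway_toAlgebra F) (by rw [hF]; exact hloc) hI' _ h0
    refine ⟨N, (mem_quasiSymIdeal_iff_free φ I).mpr ?_⟩
    change toBlowup P.proj P.surjective I _ = 0
    rw [map_mul, map_pow, ← hF, toBlowup_algebraMap]
    exact hN
  letI := (symMap ρ (idealRes I I' ρ hI)).toAlgebra
  letI := (quasiSymMap φ I φ' I' ρ hρ hI).toAlgebra
  have hmk : ∀ x, algebraMap (QuasiSym φ I) (QuasiSym φ' I') (QuasiSym.mk φ I x) =
      QuasiSym.mk φ' I' (algebraMap _ _ x) := quasiSymMap_mk φ I φ' I' ρ hρ hI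
  refine ⟨?_, ?_, ?_⟩
  · rintro ⟨_, n, rfl⟩
    simp only [← map_pow]
    rw [hmk, map_pow, map_pow]
    exact ((IsLocalization.Away.algebraMap_isUnit (algebraMap A (SymmetricAlgebra A I) f)).pow
      n).map _
  · intro z
    obtain ⟨y, rfl⟩ := QuasiSym.mk_surjective φ' I' z
    obtain ⟨n, x, h⟩ := IsLocalization.Away.surj (algebraMap A (SymmetricAlgebra A I) f) y
    refine ⟨⟨QuasiSym.mk φ I x, ⟨_, n, rfl⟩⟩, ?_⟩
    simp only [← map_pow]
    rw [hmk, hmk, ← map_mul, ← h, map_pow, map_pow]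
  · intro a b hab
    obtain ⟨x, rfl⟩ := QuasiSym.mk_surjective φ I a
    obtain ⟨y, rfl⟩ := QuasiSym.mk_surjective φ I b
    rw [hmk, hmk, ← sub_eq_zero, ← map_sub, ← map_sub, QuasiSym.mk_eq_zero] at hab
    obtain ⟨n, hn⟩ := hinj _ hab
    refine ⟨⟨_, n, rfl⟩, ?_⟩
    rw [← QuasiSym.mk_eq_zero] at hn
    simp only [mul_sub, map_sub, map_mul, map_pow, sub_eq_zero] at hn
    exact hn

lemma quasiSymMap_mem (hρ : ρ.comp φ = φ') (hI : I ≤ I'.comap ρ) {n : ℕ} {x : QuasiSym φ I}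
    (hx : x ∈ QuasiSym.grading φ I n) :
    quasiSymMap φ I φ' I' ρ hρ hI x ∈ QuasiSym.grading φ' I' n := by
  obtain ⟨x, hx, rfl⟩ := hx
  exact ⟨_, symMap_mem _ _ hx, (quasiSymMap_mk φ I φ' I' ρ hρ hI x).symm⟩

end Localization

section QuasiSymSheaf

variable {k A A' A'' : Type u} [CommRing k] [CommRing A] [CommRing A'] [CommRing A'']

lemma quasiSymMap_id (φ : k →+* A) (I : Ideal A) (ρ : A →+* A) (h : ρ = RingHom.id A)
    (hρ : ρ.comp φ = φ) (hI : I ≤ I.comap ρ) (x : QuasiSym φ I) :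
    quasiSymMap φ I φ I ρ hρ hI x = x := by
  subst h
  obtain ⟨x, rfl⟩ := QuasiSym.mk_surjective φ I x
  rw [quasiSymMap_mk]
  exact congrArg _ (symMap_id I x)

lemma quasiSymMap_comp (φ : k →+* A) (I : Ideal A) (φ' : k →+* A') (I' : Ideal A')
    (φ'' : k →+* A'') (I'' : Ideal A'') (ρ : A →+* A') (ρ' : A' →+* A'') (ρ'' : A →+* A'')
    (h : ρ'' = ρ'.comp ρ) (hρ hI hρ' hI' hρ'' hI'') (x : QuasiSym φ I) :
    quasiSymMap φ I φ'' I'' ρ'' hρ'' hI'' x =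
      quasiSymMap φ' I' φ'' I'' ρ' hρ' hI' (quasiSymMap φ I φ' I' ρ hρ hI x) := by
  subst h
  obtain ⟨x, rfl⟩ := QuasiSym.mk_surjective φ I x
  rw [quasiSymMap_mk, quasiSymMap_mk, quasiSymMap_mk]
  refine congrArg _ ?_
  have : symMap (ρ'.comp ρ) (idealRes I I'' (ρ'.comp ρ) hI'') =
      (symMap ρ' (idealRes I' I'' ρ' hI')).comp (symMap ρ (idealRes I I' ρ hI)) := by
    apply sym_ringHom_ext
    · intro a; simp
    · intro m
      rw [RingHom.comp_apply, symMap_ι, symMap_ι, symMap_ι]; rfl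
  exact congr($this x)

open Scheme Scheme.AffineZariskiSite Opposite

variable {X : Scheme.{u}}

/-- The restriction of sections of `𝒪_X` between affine open subschemes. -/
abbrev siteRes {U V : X.AffineZariskiSiteᵒᵖ} (f : U ⟶ V) : Γ(X, U.unop.1) →+* Γ(X, V.unop.1) :=
  (((toOpensFunctor X).op ⋙ X.presheaf).map f).hom

lemma siteRes_id (U : X.AffineZariskiSiteᵒᵖ) : siteRes (𝟙 U) = RingHom.id _ :=
  congr($(((toOpensFunctor X).op ⋙ X.presheaf).map_id U).hom)

lemma siteRes_comp {U V W : X.AffineZariskiSiteᵒᵖ} (f : U ⟶ V) (g : V ⟶ W) :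
    siteRes (f ≫ g) = (siteRes g).comp (siteRes f) :=
  congr($(((toOpensFunctor X).op ⋙ X.presheaf).map_comp f g).hom)

/-- The structure of a `k`-algebra on the sections of a `k`-scheme. -/
def scalars (s : X ⟶ Spec (.of k)) (U : X.Opens) : k →+* Γ(X, U) :=
  ((Scheme.ΓSpecIso (.of k)).inv ≫ s.appTop ≫ X.presheaf.map (homOfLE le_top).op).hom

lemma map_scalars (s : X ⟶ Spec (.of k)) {U V : X.Opens} (h : op U ⟶ op V) :
    (X.presheaf.map h).hom.comp (scalars s U) = scalars s V := by
  rw [scalars, scalars, ← CommRingCat.hom_comp]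
  simp only [Category.assoc, ← Functor.map_comp]
  rfl

lemma ideal_le_comap_siteRes (I : X.IdealSheafData) {U V : X.AffineZariskiSiteᵒᵖ} (f : U ⟶ V) :
    I.ideal U.unop ≤ (I.ideal V.unop).comap (siteRes f) := by
  rw [← Ideal.map_le_iff_le_comap]
  exact (I.map_ideal (U := V.unop) (V := U.unop) (toOpens_mono f.unop.le)).le

/-- The quasi-symmetric blow-up algebra of the affine open subscheme `U`. -/
abbrev quasiSymAt (s : X ⟶ Spec (.of k)) (I : X.IdealSheafData) (U : X.AffineZariskiSiteᵒᵖ) :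
    Type u :=
  QuasiSym (A := Γ(X, U.unop.1)) (scalars s U.unop.1) (I.ideal U.unop)

/-- Restriction of sections of the quasi-symmetric blow-up algebra. -/
def quasiSymRes (s : X ⟶ Spec (.of k)) (I : X.IdealSheafData) {U V : X.AffineZariskiSiteᵒᵖ}
    (f : U ⟶ V) : quasiSymAt s I U →+* quasiSymAt s I V :=
  quasiSymMap (A := Γ(X, U.unop.1)) (A' := Γ(X, V.unop.1)) (scalars s U.unop.1) (I.ideal U.unop)
    (scalars s V.unop.1) (I.ideal V.unop) (siteRes f) (map_scalars s _)
    (ideal_le_comap_siteRes I f)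

lemma quasiSymRes_id (s : X ⟶ Spec (.of k)) (I : X.IdealSheafData) (U : X.AffineZariskiSiteᵒᵖ) :
    quasiSymRes s I (𝟙 U) = RingHom.id _ :=
  RingHom.ext fun x => quasiSymMap_id (A := Γ(X, U.unop.1)) (scalars s U.unop.1)
    (I.ideal U.unop) (siteRes (𝟙 U)) (siteRes_id U) (map_scalars s _)
    (ideal_le_comap_siteRes I (𝟙 U)) x

lemma quasiSymRes_comp (s : X ⟶ Spec (.of k)) (I : X.IdealSheafData)
    {U V W : X.AffineZariskiSiteᵒᵖ} (f : U ⟶ V) (g : V ⟶ W) :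
    quasiSymRes s I (f ≫ g) = (quasiSymRes s I g).comp (quasiSymRes s I f) :=
  RingHom.ext fun x => quasiSymMap_comp (A := Γ(X, U.unop.1)) (A' := Γ(X, V.unop.1))
    (A'' := Γ(X, W.unop.1)) (scalars s U.unop.1) (I.ideal U.unop)
    (scalars s V.unop.1) (I.ideal V.unop) (scalars s W.unop.1) (I.ideal W.unop)
    (siteRes f) (siteRes g) (siteRes (f ≫ g)) (siteRes_comp f g)
    (map_scalars s _) (ideal_le_comap_siteRes I f) (map_scalars s _) (ideal_le_comap_siteRes I g)
    (map_scalars s _) (ideal_le_comap_siteRes I (f ≫ g)) x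

/-- The structure of a `Γ(X, U)`-algebra on the quasi-symmetric blow-up algebra. -/
def quasiSymUnitAt (s : X ⟶ Spec (.of k)) (I : X.IdealSheafData) (U : X.AffineZariskiSiteᵒᵖ) :
    Γ(X, U.unop.1) →+* quasiSymAt s I U :=
  (QuasiSym.mk (A := Γ(X, U.unop.1)) (scalars s U.unop.1) (I.ideal U.unop)).comp
    (algebraMap Γ(X, U.unop.1) (SymmetricAlgebra Γ(X, U.unop.1) (I.ideal U.unop)))

lemma quasiSymUnitAt_naturality (s : X ⟶ Spec (.of k)) (I : X.IdealSheafData)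
    {U V : X.AffineZariskiSiteᵒᵖ} (f : U ⟶ V) (a : Γ(X, U.unop.1)) :
    quasiSymRes s I f (quasiSymUnitAt s I U a) = quasiSymUnitAt s I V (siteRes f a) :=
  (quasiSymMap_mk (A := Γ(X, U.unop.1)) (A' := Γ(X, V.unop.1)) _ _ _ _ (siteRes f) _ _
    (algebraMap _ _ a)).trans (congrArg (QuasiSym.mk (A := Γ(X, V.unop.1)) (scalars s V.unop.1)
      (I.ideal V.unop)) (symMap_algebraMap _ _ a))

/-- The quasi-symmetric blow-up algebra of a `k`-scheme `X` along the closed subscheme defined by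
`I`. -/
def quasiSymSheaf (s : X ⟶ Spec (.of k)) (I : X.IdealSheafData) : GradedAlgebraSheaf X where
  algebra :=
    { obj U := .of (quasiSymAt s I U)
      map f := CommRingCat.ofHom (quasiSymRes s I f)
      map_id U := CommRingCat.hom_ext (quasiSymRes_id s I U)
      map_comp f g := CommRingCat.hom_ext (quasiSymRes_comp s I f g) }
  unit :=
    { app U := CommRingCat.ofHom (quasiSymUnitAt s I U)
      naturality U V f := CommRingCat.hom_ext (RingHom.ext fun a =>
        (quasiSymUnitAt_naturality s I f a).symm) }
  coequifibered := by
    rw [coequifibered_iff_forall_isLocalizationAway]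
    intro U f
    exact quasiSymMap_isLocalization (A := Γ(X, U.1)) (A' := Γ(X, (U.basicOpen f).1))
      (scalars s U.1) (I.ideal U) (scalars s (U.basicOpen f).1)
      (I.ideal (U.basicOpen f)) (siteRes (homOfLE (U.basicOpen_le f)).op) (map_scalars s _)
      (ideal_le_comap_siteRes I (homOfLE (U.basicOpen_le f)).op) f
      (U.2.isLocalization_basicOpen f) (I.map_ideal_basicOpen U f)
  grading U := QuasiSym.grading (A := Γ(X, U.unop.1)) (scalars s U.unop.1) (I.ideal U.unop)
  gradedRing U := inferInstanceAs
    (GradedRing (QuasiSym.grading (A := Γ(X, U.unop.1)) (scalars s U.unop.1) (I.ideal U.unop)))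
  map_mem {U V} f n x hx := quasiSymMap_mem (A := Γ(X, U.unop.1)) (A' := Γ(X, V.unop.1))
    (scalars s U.unop.1) (I.ideal U.unop)
    (scalars s V.unop.1) (I.ideal V.unop) (siteRes f) (map_scalars s _)
    (ideal_le_comap_siteRes I f) hx
  unit_mem U a := ⟨_, algebraMap_mem_symGrading a, rfl⟩

/-- The quasi-symmetric blow-up of a `k`-scheme `X` along the closed subscheme defined by `I`. -/
def quasiBlowup (s : X ⟶ Spec (.of k)) (I : X.IdealSheafData) : Scheme.{u} :=
  (quasiSymSheaf s I).relativeProj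

/-- The structure morphism of the quasi-symmetric blow-up. -/
def quasiBlowupToBase (s : X ⟶ Spec (.of k)) (I : X.IdealSheafData) : quasiBlowup s I ⟶ X :=
  (quasiSymSheaf s I).relativeProjToBase

end QuasiSymSheaf

section SymSheaf

open Scheme Scheme.AffineZariskiSite Opposite

/-- A quasi-coherent `𝒪_X`-module, given by its sections over the affine open subschemes: a
`Γ(X, U)`-module `M(U)` for every affine open `U`, with restriction maps to the basic open subsets
such that `M(D(f)) = M(U)_f` (every section over `D(f)` extends to `U` after multiplication by a
power of `f`, and sections over `U` with the same restriction to `D(f)` agree after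
multiplication by a power of `f`). -/
structure QCohModule (X : Scheme.{u}) where
  obj : X.AffineZariskiSiteᵒᵖ → Type u
  addCommGroup : ∀ U, AddCommGroup (obj U)
  module : ∀ U, Module Γ(X, U.unop.1) (obj U)
  res : ∀ {U V} (f : U ⟶ V), obj U →ₛₗ[siteRes f] obj V
  res_id : ∀ U (x : obj U), res (𝟙 U) x = x
  res_comp : ∀ {U V W} (f : U ⟶ V) (g : V ⟶ W) (x : obj U), res (f ≫ g) x = res g (res f x)
  exists_eq_res : ∀ (U : X.AffineZariskiSite) (f : Γ(X, U.1)) (y : obj (.op (U.basicOpen f))),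
    ∃ (n : ℕ) (x : obj (.op U)), siteRes (homOfLE (U.basicOpen_le f)).op f ^ n • y =
      res (homOfLE (U.basicOpen_le f)).op x
  exists_smul_eq : ∀ (U : X.AffineZariskiSite) (f : Γ(X, U.1)) (x y : obj (.op U)),
    res (homOfLE (U.basicOpen_le f)).op x = res (homOfLE (U.basicOpen_le f)).op y →
      ∃ n : ℕ, f ^ n • x = f ^ n • y

namespace QCohModule

variable {X : Scheme.{u}} (M : QCohModule X)

instance (U) : AddCommGroup (M.obj U) := M.addCommGroup U

instance (U) : Module Γ(X, U.unop.1) (M.obj U) := M.module U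

instance (U : X.AffineZariskiSite) : Module Γ(X, U.1) (M.obj (.op U)) := M.module (.op U)

/-- The symmetric algebra of the module of sections. -/
abbrev symAt (U : X.AffineZariskiSiteᵒᵖ) : Type u :=
  SymmetricAlgebra Γ(X, U.unop.1) (M.obj U)

/-- Restriction of sections of the symmetric algebra. -/
def symRes {U V : X.AffineZariskiSiteᵒᵖ} (f : U ⟶ V) : M.symAt U →+* M.symAt V :=
  symMap (siteRes f) (M.res f)

lemma symRes_id (U : X.AffineZariskiSiteᵒᵖ) : M.symRes (𝟙 U) = RingHom.id _ := by
  refine sym_ringHom_ext ?_ ?_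
  · intro a
    rw [symRes, symMap_algebraMap, siteRes_id]
    rfl
  · intro m
    rw [symRes, symMap_ι, M.res_id]
    rfl

lemma symRes_comp {U V W : X.AffineZariskiSiteᵒᵖ} (f : U ⟶ V) (g : V ⟶ W) :
    M.symRes (f ≫ g) = (M.symRes g).comp (M.symRes f) := by
  refine sym_ringHom_ext ?_ ?_
  · intro a
    rw [RingHom.comp_apply, symRes, symRes, symRes, symMap_algebraMap, symMap_algebraMap,
      symMap_algebraMap, siteRes_comp]
    rfl
  · intro m
    rw [RingHom.comp_apply, symRes, symRes, symRes, symMap_ι, symMap_ι, symMap_ι, M.res_comp]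

/-- The symmetric algebra of a quasi-coherent module. -/
def sym : GradedAlgebraSheaf X where
  algebra :=
    { obj U := .of (M.symAt U)
      map f := CommRingCat.ofHom (M.symRes f)
      map_id U := CommRingCat.hom_ext (M.symRes_id U)
      map_comp f g := CommRingCat.hom_ext (M.symRes_comp f g) }
  unit :=
    { app U := CommRingCat.ofHom (algebraMap Γ(X, U.unop.1) (M.symAt U))
      naturality U V f := CommRingCat.hom_ext (RingHom.ext fun a =>
        (symMap_algebraMap (siteRes f) (M.res f) a).symm) }
  coequifibered := by
    rw [coequifibered_iff_forall_isLocalizationAway]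
    intro U f
    exact symMap_isLocalization (siteRes (homOfLE (U.basicOpen_le f)).op)
      (M.res (homOfLE (U.basicOpen_le f)).op) f (U.2.isLocalization_basicOpen f)
      (M.exists_eq_res U f) (M.exists_smul_eq U f)
  grading U n := (symGrading Γ(X, U.unop.1) (M.obj U) n).toAddSubgroup
  gradedRing U :=
    { (inferInstance : GradedRing (symGrading Γ(X, U.unop.1) (M.obj U))) with }
  map_mem {U V} f n x hx := symMap_mem (siteRes f) (M.res f) hx
  unit_mem U a := algebraMap_mem_symGrading a

/-- The sections of the direct image of an ideal sheaf. -/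
def pushforwardIdealAt {V : Scheme.{u}} (i : V ⟶ X) [IsAffineHom i] (I : V.IdealSheafData)
    (U : X.AffineZariskiSiteᵒᵖ) : Type u :=
  I.ideal ⟨i ⁻¹ᵁ U.unop.1, U.unop.2.preimage i⟩

section

variable {V : Scheme.{u}} (i : V ⟶ X) [IsAffineHom i] (I : V.IdealSheafData)

instance (U : X.AffineZariskiSiteᵒᵖ) : AddCommGroup (pushforwardIdealAt i I U) :=
  inferInstanceAs (AddCommGroup (I.ideal ⟨i ⁻¹ᵁ U.unop.1, U.unop.2.preimage i⟩))

instance (U : X.AffineZariskiSiteᵒᵖ) : Module Γ(X, U.unop.1) (pushforwardIdealAt i I U) :=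
  Module.compHom (I.ideal ⟨i ⁻¹ᵁ U.unop.1, U.unop.2.preimage i⟩) (i.app U.unop.1).hom

/-- The restriction of sections of `i_* 𝒪_V`. -/
abbrev preimageRes {U W : X.AffineZariskiSiteᵒᵖ} (f : U ⟶ W) :
    Γ(V, i ⁻¹ᵁ U.unop.1) →+* Γ(V, i ⁻¹ᵁ W.unop.1) :=
  (V.presheaf.map (homOfLE (i.preimage_mono (toOpens_mono f.unop.le))).op).hom

lemma preimageRes_app {U W : X.AffineZariskiSiteᵒᵖ} (f : U ⟶ W) (a : Γ(X, U.unop.1)) :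
    preimageRes i f ((i.app U.unop.1).hom a) = (i.app W.unop.1).hom (siteRes f a) :=
  congr($(i.naturality ((toOpensFunctor X).map f.unop).op).hom a).symm

lemma ideal_le_comap_preimageRes {U W : X.AffineZariskiSiteᵒᵖ} (f : U ⟶ W) :
    I.ideal ⟨i ⁻¹ᵁ U.unop.1, U.unop.2.preimage i⟩ ≤
      (I.ideal ⟨i ⁻¹ᵁ W.unop.1, W.unop.2.preimage i⟩).comap (preimageRes i f) := by
  rw [← Ideal.map_le_iff_le_comap]
  exact (I.map_ideal (U := ⟨i ⁻¹ᵁ W.unop.1, W.unop.2.preimage i⟩)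
    (V := ⟨i ⁻¹ᵁ U.unop.1, U.unop.2.preimage i⟩) _).le

/-- Restriction of sections of the direct image of an ideal sheaf. -/
def pushforwardIdealRes {U W : X.AffineZariskiSiteᵒᵖ} (f : U ⟶ W) :
    pushforwardIdealAt i I U →ₛₗ[siteRes f] pushforwardIdealAt i I W where
  toFun := idealRes _ _ (preimageRes i f) (ideal_le_comap_preimageRes i I f)
  map_add' x y := map_add (idealRes _ _ (preimageRes i f) (ideal_le_comap_preimageRes i I f)) x y
  map_smul' a x := by
    refine ((idealRes _ _ (preimageRes i f) (ideal_le_comap_preimageRes i I f)).map_smulₛₗ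
      ((i.app U.unop.1).hom a) x).trans ?_
    rw [preimageRes_app]
    rfl

/-- The direct image `i_* I` of a quasi-coherent ideal sheaf `I` under an affine morphism `i`. -/
def pushforwardIdeal : QCohModule X where
  obj := pushforwardIdealAt i I
  addCommGroup U := inferInstance
  module U := inferInstance
  res f := pushforwardIdealRes i I f
  res_id U x := by
    refine Subtype.ext ?_
    exact congr($(V.presheaf.map_id (.op (i ⁻¹ᵁ U.unop.1))).hom x.1)
  res_comp {U W T} f g x := by
    refine Subtype.ext ?_
    exact congr($(V.presheaf.map_comp (homOfLE (i.preimage_mono (toOpens_mono f.unop.le))).op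
      (homOfLE (i.preimage_mono (toOpens_mono g.unop.le))).op).hom x.1)
  exists_eq_res U f y := by
    obtain ⟨n, x, h⟩ := idealRes_surj _ (preimageRes i (homOfLE (U.basicOpen_le f)).op)
      ((i.app U.1).hom f) ((U.2.preimage i).isLocalization_of_eq_basicOpen _ _
        (i.preimage_basicOpen f)) _
      (I.map_ideal (U := ⟨i ⁻¹ᵁ X.basicOpen f, (U.2.basicOpen f).preimage i⟩)
        (V := ⟨i ⁻¹ᵁ U.1, U.2.preimage i⟩) _)
      (ideal_le_comap_preimageRes i I (homOfLE (U.basicOpen_le f)).op) y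
    refine ⟨n, x, Eq.trans ?_ h⟩
    rw [preimageRes_app, ← map_pow (i.app _).hom]
    rfl
  exists_smul_eq U f x y hxy := by
    obtain ⟨n, h⟩ := idealRes_inj _ (preimageRes i (homOfLE (U.basicOpen_le f)).op)
      ((i.app U.1).hom f) ((U.2.preimage i).isLocalization_of_eq_basicOpen _ _
        (i.preimage_basicOpen f)) _
      (ideal_le_comap_preimageRes i I (homOfLE (U.basicOpen_le f)).op) x y hxy
    refine ⟨n, ?_⟩
    rw [← map_pow] at h
    exact h

end

end QCohModule

end SymSheaf

section Jacobian

/-- The ideal generated by an ideal `I` of a `k`-algebra and by the derivatives `θ h` of the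
elements `h` of `I` along all `k`-derivations `θ`. If `Spec A` is smooth with local coordinates
`x₁, …, xₙ` and `I = (h)`, it is generated by `h` and by the partial derivatives `∂h/∂xᵢ`. -/
def jacobian (k : Type*) {A : Type*} [CommRing k] [CommRing A] [Algebra k A] (I : Ideal A) :
    Ideal A :=
  I ⊔ Ideal.span {a | ∃ (θ : Derivation k A A) (h : A), h ∈ I ∧ θ h = a}

section

variable {k A A' : Type u} [CommRing k] [CommRing A] [CommRing A'] [Algebra k A] [Algebra k A']
  [Algebra A A'] [IsScalarTower k A A']

lemma exists_derivation_extends (f : A) [IsLocalization.Away f A']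
    (θ : Derivation k A A) :
    ∃ θ' : Derivation k A' A', ∀ a, θ' (algebraMap A A' a) = algebraMap A A' (θ a) := by
  let g : Ω[A⁄k] →ₗ[A] A' := (Algebra.linearMap A A') ∘ₗ θ.liftKaehlerDifferential
  let g' : Ω[A'⁄k] →ₗ[A] A' := IsLocalizedModule.lift (.powers f)
    (KaehlerDifferential.map k k A A') g (fun x =>
      IsLocalizedModule.map_units (Algebra.linearMap A A') x)
  let g'' : Ω[A'⁄k] →ₗ[A'] A' := g'.extendScalarsOfIsLocalization (.powers f) A'
  refine ⟨g''.compDer (KaehlerDifferential.D k A'), fun a => ?_⟩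
  change g' (KaehlerDifferential.D k A' (algebraMap A A' a)) = _
  rw [← KaehlerDifferential.map_D k k A A']
  refine (IsLocalizedModule.lift_apply (.powers f) (KaehlerDifferential.map k k A A') g _ _).trans ?_
  simp [g]

lemma exists_derivation_restricts [Algebra.FinitePresentation k A] (f : A)
    [IsLocalization.Away f A'] (θ' : Derivation k A' A') :
    ∃ (n : ℕ) (θ : Derivation k A A), ∀ a, algebraMap A A' (θ a) =
      algebraMap A A' f ^ n * θ' (algebraMap A A' a) := by
  obtain ⟨g, ⟨_, n, rfl⟩, h⟩ := Module.FinitePresentation.exists_lift_of_isLocalizedModule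
    (.powers f) (Algebra.linearMap A A') (θ'.compAlgebraMap A).liftKaehlerDifferential
  refine ⟨n, g.compDer (KaehlerDifferential.D k A), fun a => ?_⟩
  have := congr($h (KaehlerDifferential.D k A a))
  refine this.trans ?_
  change (f ^ n) • (θ'.compAlgebraMap A).liftKaehlerDifferential _ = _
  rw [Derivation.liftKaehlerDifferential_comp_D, Algebra.smul_def, map_pow]
  rfl

lemma map_jacobian [Algebra.FinitePresentation k A] (f : A) [IsLocalization.Away f A']
    (I : Ideal A) :
    (jacobian k I).map (algebraMap A A') = jacobian k (I.map (algebraMap A A')) := by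
  apply le_antisymm
  · rw [jacobian, jacobian, Ideal.map_sup, Ideal.map_span]
    refine sup_le_sup_left (Ideal.span_mono ?_) _
    rintro _ ⟨_, ⟨θ, h, hh, rfl⟩, rfl⟩
    obtain ⟨θ', hθ'⟩ := exists_derivation_extends (A' := A') f θ
    exact ⟨θ', _, Ideal.mem_map_of_mem _ hh, hθ' h⟩
  · have hle : I.map (algebraMap A A') ≤ (jacobian k I).map (algebraMap A A') :=
      Ideal.map_mono le_sup_left
    refine sup_le hle (Ideal.span_le.mpr ?_)
    rintro _ ⟨θ', h', hh', rfl⟩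
    obtain ⟨⟨⟨h, hh⟩, ⟨_, n, rfl⟩⟩, hn⟩ :=
      (IsLocalization.mem_map_algebraMap_iff (.powers f) A').mp hh'
    obtain ⟨m, θ, hθ⟩ := exists_derivation_restricts (A' := A') f θ'
    have h1 : algebraMap A A' (θ h) ∈ (jacobian k I).map (algebraMap A A') :=
      Ideal.mem_map_of_mem _ (le_sup_right (a := I) (Ideal.subset_span ⟨θ, h, hh, rfl⟩))
    have hu : IsUnit (algebraMap A A' f ^ m * algebraMap A A' f ^ n) :=
      ((IsLocalization.Away.algebraMap_isUnit f).pow m).mul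
        ((IsLocalization.Away.algebraMap_isUnit f).pow n)
    refine (Ideal.unit_mul_mem_iff_mem _ hu).mp ?_
    have h2 : algebraMap A A' f ^ m * algebraMap A A' f ^ n * θ' h' = algebraMap A A' (θ h) -
        (algebraMap A A' f ^ m * θ' (algebraMap A A' (f ^ n))) * h' := by
      dsimp only at hn
      rw [hθ, ← hn, Derivation.leibniz, map_pow]
      simp only [smul_eq_mul]
      ring
    rw [h2]
    exact sub_mem h1 (Ideal.mul_mem_left _ _ (hle hh'))

end

lemma scalars_finitePresentation {k : Type u} [CommRing k] {X : Scheme.{u}}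
    (s : X ⟶ Spec (.of k)) [LocallyOfFinitePresentation s] (U : X.affineOpens) :
    (scalars s U.1).FinitePresentation := by
  have h := s.finitePresentation_appLE (isAffineOpen_top _) U.2 le_top
  exact h.comp (RingHom.FinitePresentation.of_bijective
    (ConcreteCategory.bijective_of_isIso (Scheme.ΓSpecIso (.of k)).inv))

/-- The ideal sheaf in `𝒪_X` of the singular subscheme of the hypersurface defined by `D` in a
`k`-scheme `X` (the Jacobian ideal sheaf): locally it is generated by `h` and its partial
derivatives, where `h` is an equation of the hypersurface. -/
def jacobianIdeal {k : Type u} [CommRing k] {X : Scheme.{u}} (s : X ⟶ Spec (.of k))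
    [LocallyOfFinitePresentation s] (D : X.IdealSheafData) : X.IdealSheafData where
  ideal U :=
    letI := (scalars s U.1).toAlgebra
    jacobian k (D.ideal U)
  map_ideal_basicOpen U f := by
    letI := (scalars s U.1).toAlgebra
    letI := (scalars s (X.affineBasicOpen f).1).toAlgebra
    letI : Algebra Γ(X, U.1) Γ(X, (X.affineBasicOpen f).1) :=
      (X.presheaf.map (homOfLE <| X.basicOpen_le f).op).hom.toAlgebra
    haveI : IsScalarTower k Γ(X, U.1) Γ(X, (X.affineBasicOpen f).1) :=
      IsScalarTower.of_algebraMap_eq' (map_scalars s _).symm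
    haveI : IsLocalization.Away f Γ(X, (X.affineBasicOpen f).1) :=
      U.2.isLocalization_basicOpen f
    haveI : Algebra.FinitePresentation k Γ(X, U.1) := scalars_finitePresentation s U
    refine (map_jacobian (A' := Γ(X, (X.affineBasicOpen f).1)) f (D.ideal U)).trans ?_
    exact congrArg (jacobian k) (D.map_ideal_basicOpen U f)

/-- An effective Cartier divisor: a closed subscheme defined locally by one equation which is not
a zero divisor. -/
def IsEffectiveCartier {X : Scheme.{u}} (D : X.IdealSheafData) : Prop :=
  ∀ x : X, ∃ U : X.affineOpens, x ∈ U.1 ∧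
    ∃ h ∈ nonZeroDivisors Γ(X, U.1), D.ideal U = Ideal.span {h}

/-- The inclusion of an ideal `J` as the degree one part of its Rees algebra `⨁ J^n`. -/
def toRees {A : Type*} [CommRing A] (J : Ideal A) : J →ₗ[A] reesAlgebra J where
  toFun x := ⟨Polynomial.monomial 1 x.1, reesAlgebra.monomial_mem.mpr (by simp)⟩
  map_add' x y := Subtype.ext (map_add (Polynomial.monomial 1) x.1 y.1)
  map_smul' a x := Subtype.ext (map_smul (Polynomial.monomial 1) a x.1)

/-- An ideal sheaf `J` is of linear type if the canonical epimorphism from its symmetric algebra to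
its Rees algebra is an isomorphism. -/
def IsLinearType {X : Scheme.{u}} (J : X.IdealSheafData) : Prop :=
  ∀ U : X.affineOpens, Function.Bijective (SymmetricAlgebra.lift (toRees (J.ideal U)))

end Jacobian

end QuasiBlowup

end

/-! Over an affine open `U` of X let R be the ring of X, K ⊆ J the ideals of D and of D^s in R, A =
R/K and I = J/K. The sections of Sym(i_* I) over `U` form Sym_R(J/K), which is the quotient of
Sym_R(J) by the ideal generated by K ⊆ J in degree one. When J is of linear type, Sym_R(J) is the
Rees algebra ⨁ J^n, so for n ≥ 1 the degree n part of this quotient is J^n / K J^(n-1). That is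
exactly the degree n part of the blow-up algebra attached to the surjection R → A. In degree zero
the two differ: R on one side, A on the other.

The quasi-symmetric algebra lies in between. There are graded surjections Sym_R(I) → Sym_A(I) →
`QuasiSym` → blow-up algebra of R → A, the last one because X itself is among the ambient schemes
over which the limit is taken. The composite is injective in positive degrees
(`eq_zero_of_toBlowup_eq_zero`), hence so is Sym_R(I) → `QuasiSym`, which is also surjective in
every degree (`exists_symMap_eq_of_mem`). No other ambient scheme has to be examined.

Proj does not see degree zero: a graded homomorphism that is surjective, and injective in positive
degrees, induces an isomorphism (`isIso_projMap`). This gives an isomorphism over each `U`. The two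
sides are glued along different index categories, the affine opens of X and those of D;
`nonempty_glued_iso` compares them through the preimages in D of affine opens of X. Finally
`comap_ideal_comap` identifies the preimage in R of the ideal I of A with J, so that the linear type
hypothesis on X applies. -/

noncomputable section

namespace QuasiBlowup

/-! ### Symmetric algebras of ideals of linear type -/

section LinearType

open Polynomial

variable {R A M : Type*} [CommRing R] [CommRing A] [AddCommGroup M] [Module R M]

/-- The canonical map to the Rees algebra respects degrees, so the image of a homogeneous element is
controlled by a single coefficient. -/
lemma lift_toRees_homogeneous (J : Ideal R) {n : ℕ} {y : SymmetricAlgebra R J}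
    (hy : y ∈ symGrading R J n) :
    ∃ (r : R) (hr : r ∈ J ^ n), SymmetricAlgebra.lift (toRees J) y =
      ⟨monomial n r, reesAlgebra.monomial_mem.mpr hr⟩ := by
  induction hy using Submodule.pow_induction_on_left' with
  | algebraMap r => exact ⟨r, by simp, AlgHom.commutes _ r⟩
  | add x y i hx hy ihx ihy =>
    obtain ⟨r, hr, h⟩ := ihx
    obtain ⟨s, hs, h'⟩ := ihy
    refine ⟨r + s, add_mem hr hs, ?_⟩
    rw [map_add, h, h']
    exact Subtype.ext (map_add (monomial i) r s).symm
  | mem_mul m hm i x hx ih =>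
    obtain ⟨m, rfl⟩ := hm
    obtain ⟨s, hs, h⟩ := ih
    refine ⟨m.1 * s, by rw [pow_succ']; exact Ideal.mul_mem_mul m.2 hs, ?_⟩
    rw [map_mul, h, SymmetricAlgebra.lift_ι_apply]
    refine Subtype.ext ((monomial_mul_monomial 1 i m.1 s).trans ?_)
    rw [add_comm]

/-- Products of generators lift factor by factor, so preimages can be found without leaving the
degree. It is needed both over a fixed ring, for J → J/K, and along the change of rings R → A. -/
lemma exists_symMap_eq_of_mem {N : Type*} [AddCommGroup N] [Module A N] (ρ : R →+* A)
    (hρ : Function.Surjective ρ) (g : M →ₛₗ[ρ] N) (hg : Function.Surjective g) {n : ℕ}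
    {y : SymmetricAlgebra A N} (hy : y ∈ symGrading A N n) :
    ∃ x ∈ symGrading R M n, symMap ρ g x = y := by
  induction hy using Submodule.pow_induction_on_left' with
  | algebraMap r =>
    obtain ⟨r, rfl⟩ := hρ r
    exact ⟨algebraMap R _ r, algebraMap_mem_symGrading r, symMap_algebraMap _ _ r⟩
  | add x y i hx hy ihx ihy =>
    obtain ⟨a, ha, rfl⟩ := ihx
    obtain ⟨b, hb, rfl⟩ := ihy
    exact ⟨a + b, add_mem ha hb, map_add _ _ _⟩
  | mem_mul m hm i x hx ih =>
    obtain ⟨m, rfl⟩ := hm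
    obtain ⟨m, rfl⟩ := hg m
    obtain ⟨a, ha, rfl⟩ := ih
    refine ⟨SymmetricAlgebra.ι R M m * a, ?_, by rw [map_mul, symMap_ι]⟩
    rw [Nat.succ_eq_add_one, add_comm]
    exact SetLike.mul_mem_graded (ι_mem_symGrading m) ha

/-- If the preimage `J` of `I` under a surjection `π : R → A` is of linear type, an element of
positive degree of the symmetric algebra over `R` of `I` is determined by its image in the blow-up
algebra corresponding to `π`. -/
lemma eq_zero_of_toBlowup_eq_zero (π : R →+* A) (hπ : Function.Surjective π) (I : Ideal A)
    (hlin : Function.Bijective (SymmetricAlgebra.lift (toRees (I.comap π))))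
    (g : M →ₛₗ[π] I) (hg : Function.Bijective g) {n : ℕ} (hn : 0 < n) {x : SymmetricAlgebra R M}
    (hx : x ∈ symGrading R M n) (h0 : toBlowup π hπ I (symMap π g x) = 0) : x = 0 := by
  let J := I.comap π
  let e := Equiv.ofBijective g hg
  have he : ∀ y, g (e.symm y) = y := e.apply_symm_apply
  -- Since `g` identifies `M` with I = J/K, this is the quotient map from J to J/K; it kills exactly
  -- K.
  let q : J →ₗ[R] M :=
    { toFun j := e.symm ⟨π j, j.2⟩
      map_add' a b := hg.1 (by rw [map_add, he, he, he]; exact Subtype.ext (map_add π _ _))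
      map_smul' r a := hg.1 (by
        rw [RingHom.id_apply, g.map_smulₛₗ, he, he]; exact Subtype.ext (map_mul π _ _)) }
  have hgq : ∀ j : J, g (q j) = ⟨π j, j.2⟩ := fun j => he _
  have hq : Function.Surjective q := by
    intro m
    obtain ⟨r, hr⟩ := hπ (g m).1
    exact ⟨⟨r, by rw [Ideal.mem_comap, hr]; exact (g m).2⟩,
      hg.1 ((hgq _).trans (Subtype.ext hr))⟩
  -- The two routes from Sym_R(J) to the blow-up algebra agree: through Sym_R(M) and Sym_A(I), or
  -- through the Rees algebra of J. It suffices to compare them on scalars and on degree one.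
  have hcomm : ∀ y : SymmetricAlgebra R J, toBlowup π hπ I (symMap π g (symMap (RingHom.id R) q y)) =
      BlowupAlgebra.mk π I (SymmetricAlgebra.lift (toRees J) y) := by
    intro y
    suffices h : ((toBlowup π hπ I).comp (symMap π g)).comp (symMap (RingHom.id R) q) =
        (BlowupAlgebra.mk π I).comp
          (SymmetricAlgebra.lift (toRees J) : SymmetricAlgebra R J →ₐ[R] reesAlgebra J).toRingHom
      from congr($h y)
    apply sym_ringHom_ext
    · intro r
      simp only [RingHom.comp_apply, symMap_algebraMap, RingHom.id_apply]
      rw [toBlowup_algebraMap]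
      exact congrArg (BlowupAlgebra.mk π I) (AlgHom.commutes _ r).symm
    · intro j
      simp only [RingHom.comp_apply, symMap_ι, hgq]
      refine (toBlowup_ι π hπ I j.1 j.2).trans ?_
      exact congrArg (BlowupAlgebra.mk π I) (SymmetricAlgebra.lift_ι_apply (toRees J) j).symm
  -- Replace `x` by a lift `y` of the same degree in Sym_R(J), with image r t^n in the Rees algebra.
  -- Vanishing in the blow-up algebra then says that r lies in K J^(n-1).
  obtain ⟨y, hy, rfl⟩ := exists_symMap_eq_of_mem _ Function.surjective_id q hq hx
  obtain ⟨r, hr, hyr⟩ := lift_toRees_homogeneous J hy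
  rw [hcomm, BlowupAlgebra.mk_eq_zero] at h0
  have hrK : r ∈ RingHom.ker π * J ^ (n - 1) := by
    have := h0 n
    rw [hyr] at this
    simpa using this
  -- Every r t^n with r in K J^(n-1) comes from the kernel of Sym_R(J) → Sym_R(M). For r = ab with a
  -- in K and b in J^(n-1), take the product of a, placed in degree one, with a preimage of b
  -- t^(n-1); that preimage exists by surjectivity in `hlin`, and `q` kills a.
  have key : ∀ r ∈ RingHom.ker π * J ^ (n - 1), ∃ z : SymmetricAlgebra R J,
      symMap (RingHom.id R) q z = 0 ∧
        ((SymmetricAlgebra.lift (toRees J) z : reesAlgebra J) : R[X]) = monomial n r := by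
    intro r hr
    induction hr using Submodule.mul_induction_on' with
    | mem_mul_mem a ha b hb =>
      have haJ : a ∈ J := by
        rw [Ideal.mem_comap, RingHom.mem_ker.mp ha]; exact zero_mem _
      obtain ⟨z, hz⟩ := hlin.2 ⟨monomial (n - 1) b, reesAlgebra.monomial_mem.mpr hb⟩
      refine ⟨SymmetricAlgebra.ι R J ⟨a, haJ⟩ * z, ?_, ?_⟩
      · have : q ⟨a, haJ⟩ = 0 := hg.1 (by
          rw [hgq, map_zero]; exact Subtype.ext (RingHom.mem_ker.mp ha))
        rw [map_mul, symMap_ι, this, map_zero, zero_mul]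
      · rw [map_mul, hz, SymmetricAlgebra.lift_ι_apply]
        refine (monomial_mul_monomial 1 (n - 1) a b).trans ?_
        -- Positivity of n is essential: for n = 0 the truncated exponent makes K J^(n-1) equal to
        -- K, while Sym_R(M) has all of R in degree zero.
        rw [Nat.add_sub_cancel' hn]
    | add a _ b _ ha hb =>
      obtain ⟨z, hz, hz'⟩ := ha
      obtain ⟨w, hw, hw'⟩ := hb
      refine ⟨z + w, by rw [map_add, hz, hw, add_zero], ?_⟩
      rw [map_add, Subalgebra.coe_add, hz', hw', map_add]
  obtain ⟨z, hz, hz'⟩ := key r hrK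
  -- Injectivity of Sym_R(J) → Rees: the lift `y` equals the element `z` just found, which dies in
  -- Sym_R(M).
  have hyz : y = z := hlin.1 (hyr.trans (Subtype.ext hz'.symm))
  rw [hyz, hz]

end LinearType

/-! ### Proj depends only on positive degrees -/

section ProjIso

open HomogeneousLocalization HomogeneousIdeal

variable {S S' : Type u} [CommRing S] [CommRing S'] {σ τ : Type u} [SetLike σ S]
  [AddSubgroupClass σ S] [SetLike τ S'] [AddSubgroupClass τ S'] {𝒜 : ℕ → σ} [GradedRing 𝒜]
  {ℬ : ℕ → τ} [GradedRing ℬ] (φ : 𝒜 →+*ᵍ ℬ)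

lemma irrelevant_le_map_of_surjective (hsurj : ∀ n, ∀ b ∈ ℬ n, ∃ a ∈ 𝒜 n, φ a = b) :
    HomogeneousIdeal.irrelevant ℬ ≤ (HomogeneousIdeal.irrelevant 𝒜).map φ := by
  rw [← toIdeal_le_toIdeal_iff, HomogeneousIdeal.toIdeal_irrelevant_le]
  intro i hi b hb
  obtain ⟨a, ha, rfl⟩ := hsurj i b hb
  exact Ideal.mem_map_of_mem _ (HomogeneousIdeal.mem_irrelevant_of_mem 𝒜 hi ha)

/-- A fraction a/s^n can be expanded by a power of `s`, an element of positive degree, so the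
numerator can always be moved to where injectivity is known. -/
lemma awayMap_bijective (hsurj : ∀ n, ∀ b ∈ ℬ n, ∃ a ∈ 𝒜 n, φ a = b)
    (hinj : ∀ n, 0 < n → ∀ a ∈ 𝒜 n, φ a = 0 → a = 0) {m : ℕ} (hm : 0 < m) (s : S)
    (hs : s ∈ 𝒜 m) : Function.Bijective (Away.map φ s) := by
  constructor
  · rw [injective_iff_map_eq_zero]
    intro z hz
    obtain ⟨n, a, ha, rfl⟩ := Away.mk_surjective 𝒜 hs z
    rw [Away.map_mk] at hz
    have hz' := congrArg HomogeneousLocalization.val hz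
    rw [Away.val_mk, HomogeneousLocalization.val_zero, Localization.mk_eq_mk',
      IsLocalization.mk'_eq_zero_iff] at hz'
    obtain ⟨⟨_, k, rfl⟩, hk⟩ := hz'
    -- One more factor `s` than needed to kill the image of `a`: for n = 0 and k = 0 the product s^k
    -- a would have degree zero, where `hinj` says nothing.
    have hmem : s ^ (k + 1) * a ∈ 𝒜 ((k + 1) • m + n • m) :=
      SetLike.mul_mem_graded (SetLike.pow_mem_graded _ hs) ha
    have h0 : s ^ (k + 1) * a = 0 := by
      refine hinj _ ?_ _ hmem ?_
      · rw [smul_eq_mul]; positivity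
      · have hk' : φ s ^ k * φ a = 0 := hk
        rw [map_mul, map_pow, pow_succ', mul_assoc, hk', mul_zero]
    apply HomogeneousLocalization.val_injective
    rw [Away.val_mk, HomogeneousLocalization.val_zero, Localization.mk_eq_mk',
      IsLocalization.mk'_eq_zero_iff]
    exact ⟨⟨_, k + 1, rfl⟩, h0⟩
  · intro z
    obtain ⟨n, b, hb, rfl⟩ := Away.mk_surjective ℬ (φ.map_mem hs) z
    obtain ⟨a, ha, rfl⟩ := hsurj _ b hb
    exact ⟨Away.mk 𝒜 hs n a ha, Away.map_mk ..⟩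

/-- A homomorphism of graded rings which is surjective, and injective in positive degrees, induces
an isomorphism of homogeneous spectra. -/
lemma isIso_projMap (hsurj : ∀ n, ∀ b ∈ ℬ n, ∃ a ∈ 𝒜 n, φ a = b)
    (hinj : ∀ n, 0 < n → ∀ a ∈ 𝒜 n, φ a = 0 → a = 0)
    (hφ : HomogeneousIdeal.irrelevant ℬ ≤ (HomogeneousIdeal.irrelevant 𝒜).map φ) :
    IsIso (Proj.map φ hφ) := by
  -- Being an isomorphism is local on the target. The preimage of the chart D₊(s) is D₊(φ s), and
  -- over this chart the morphism is Spec of `Away.map φ s`.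
  refine IsZariskiLocalAtTarget.of_openCover (P := MorphismProperty.isomorphisms Scheme)
    (𝒰 := (Proj.affineOpenCover 𝒜).openCover) ?_
  rintro ⟨⟨m, hm⟩, ⟨s, hs⟩⟩
  replace hs : s ∈ 𝒜 m := hs
  have sq : IsPullback (Spec.map (CommRingCat.ofHom (Away.map φ s)))
      (Proj.awayι ℬ (φ s) (φ.map_mem hs) hm) (Proj.awayι 𝒜 s hs hm) (Proj.map φ hφ) := by
    refine IsOpenImmersion.isPullback _ _ _ _ (Proj.awayι_comp_map φ hφ hm s hs) ?_
    rw [Proj.opensRange_awayι, Proj.opensRange_awayι, Proj.map_preimage_basicOpen]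
  have : IsIso (CommRingCat.ofHom (Away.map φ s)) :=
    (ConcreteCategory.isIso_iff_bijective _).mpr (awayMap_bijective φ hsurj hinj hm s hs)
  change IsIso (pullback.snd (Proj.map φ hφ) (Proj.awayι 𝒜 s hs hm))
  rw [← sq.flip.isoPullback_inv_snd]
  infer_instance

end ProjIso

/-! ### Compatibility of Proj with a change of base ring -/

section ProjToSpec

variable {A A' S S' : Type u} [CommRing A] [CommRing A'] [CommRing S] [CommRing S']
  {σ τ : Type u} [SetLike σ S] [AddSubgroupClass σ S] [SetLike τ S'] [AddSubgroupClass τ S']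
  {𝒜 : ℕ → σ} [GradedRing 𝒜] {ℬ : ℕ → τ} [GradedRing ℬ]

/-- By `hφ` the charts D₊(φ s) cover Proj of the target; on each of them the claim is the ring
identity `awayMap_awayConst`. In contrast with `isPullback_projMap`, `ρ` need not be a localization,
which allows R → R/K. -/
lemma projMap_projToSpec (φ : 𝒜 →+*ᵍ ℬ) (ρ : A →+* A') (α : A →+* S) (α' : A' →+* S')
    (hα : ∀ a, α a ∈ 𝒜 0) (hα' : ∀ a, α' a ∈ ℬ 0) (comm : ∀ a, φ (α a) = α' (ρ a))
    (hφ : HomogeneousIdeal.irrelevant ℬ ≤ (HomogeneousIdeal.irrelevant 𝒜).map φ) :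
    Proj.map φ hφ ≫ projToSpec 𝒜 α hα =
      projToSpec ℬ α' hα' ≫ Spec.map (CommRingCat.ofHom ρ) := by
  refine (Proj.mapAffineOpenCover φ hφ).openCover.hom_ext _ _ ?_
  rintro ⟨⟨m, hm⟩, ⟨s, hs⟩⟩
  replace hs : s ∈ 𝒜 m := hs
  change Proj.awayι ℬ (φ s) (φ.map_mem hs) hm ≫ _ = Proj.awayι ℬ (φ s) (φ.map_mem hs) hm ≫ _
  rw [← Category.assoc, Proj.awayι_comp_map φ hφ hm s hs, Category.assoc, awayι_projToSpec,
    ← Category.assoc, awayι_projToSpec, ← Spec.map_comp, ← Spec.map_comp]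
  refine congrArg Spec.map (CommRingCat.hom_ext (RingHom.ext fun a => ?_))
  exact awayMap_awayConst φ ρ α α' hα hα' comm s hs a

end ProjToSpec

/-! ### Comparing relative gluings over two bases -/

section RelativeGluing

variable {X Y : Scheme.{u}} {𝒰 : X.OpenCover} [Category 𝒰.I₀] [𝒰.LocallyDirected]
  [Small.{u} 𝒰.I₀] [Quiver.IsThin 𝒰.I₀] {𝒱 : Y.OpenCover} [Category 𝒱.I₀] [𝒱.LocallyDirected]
  [Small.{u} 𝒱.I₀] [Quiver.IsThin 𝒱.I₀]

open Scheme.Cover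

/-- Let `i : Y ⟶ X` be a morphism, and let the preimages of the members of a cover of `X` be members
of a cover of `Y`. Relative gluing data on `X` and on `Y` whose local pieces are compatibly
isomorphic glue to isomorphic schemes over `X`. -/
lemma nonempty_glued_iso (i : Y ⟶ X) (d : RelativeGluingData 𝒰) (d' : RelativeGluingData 𝒱)
    (F : 𝒰.I₀ ⥤ 𝒱.I₀) (j : ∀ a, 𝒱.X (F.obj a) ⟶ 𝒰.X a)
    (hj : ∀ a, IsPullback (j a) (𝒱.f (F.obj a)) (𝒰.f a) i) (e : F ⋙ d'.functor ≅ d.functor)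
    (he : ∀ a, e.hom.app a ≫ d.natTrans.app a = d'.natTrans.app (F.obj a) ≫ j a) :
    Nonempty (Over.mk d.toBase ≅ Over.mk (d'.toBase ≫ i)) := by
  have : HasColimit (F ⋙ d'.functor) := hasColimit_of_iso e
  -- The pieces of `d` are those pieces of `d'` that are indexed through `F`, so there is a map of
  -- colimits. `F` need not be final; that `Φ` is invertible is checked locally on X.
  let Φ : d.glued ⟶ d'.glued :=
    (HasColimit.isoOfNatIso e).inv ≫ colimit.pre d'.functor F
  have hΦ (a) : e.hom.app a ≫ colimit.ι d.functor a ≫ Φ = colimit.ι d'.functor (F.obj a) := by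
    simp [Φ]
  -- The piece of `d` at `a` is also the restriction of `d'.glued` to that member of the cover of X:
  -- paste the gluing square of `d'` onto the square `hj a`, then transport along `e`.
  have hloc (a) : IsPullback (d.natTrans.app a) (colimit.ι d.functor a ≫ Φ) (𝒰.f a)
      (d'.toBase ≫ i) := by
    have h := ((d'.isPullback_natTrans_ι_toBase (F.obj a)).flip.paste_vert (hj a).flip).flip
    exact h.of_iso (e.app a) (Iso.refl _) (Iso.refl _) (Iso.refl _)
      ((Category.comp_id _).trans (he a).symm) ((Category.comp_id _).trans (hΦ a).symm)
      ((Category.comp_id _).trans (Category.id_comp _).symm)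
      ((Category.comp_id _).trans (Category.id_comp _).symm)
  -- Both glued schemes restrict to the same piece over each member of `𝒰`, so this square is
  -- cartesian. It exhibits `Φ` as a base change of the identity of X.
  have hpb : IsPullback d.toBase Φ (𝟙 X) (d'.toBase ≫ i) := by
    refine Scheme.isPullback_of_openCover _ _ _ _ 𝒰 fun a => ?_
    have h := (d.isPullback_natTrans_ι_toBase a).flip
    refine (hloc a).of_iso h.isoPullback (Iso.refl _) (Iso.refl _) (Iso.refl _)
      ((Category.comp_id _).trans h.isoPullback_hom_snd.symm) ?_
      ((Category.comp_id _).trans ((Category.id_comp _).trans (Category.comp_id _)).symm)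
      ((Category.comp_id _).trans (Category.id_comp _).symm)
    exact (Category.comp_id _).trans (h.isoPullback_hom_fst_assoc Φ).symm
  have : IsIso Φ := hpb.isIso_snd_of_isIso
  exact ⟨Over.isoMk (asIso Φ) (by simpa using hpb.w.symm)⟩

end RelativeGluing

/-! ### Homomorphisms of graded algebras along an affine morphism -/

section AffineMorphism

open Scheme Scheme.AffineZariskiSite Opposite

variable {X Y : Scheme.{u}}

/-- Naturality of the identification of an affine open with the spectrum of its sections; it may be
tested after the monomorphism into X. -/
lemma specMap_app_isoSpec_inv (i : Y ⟶ X) {U : X.Opens} (hU : IsAffineOpen U)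
    (hV : IsAffineOpen (i ⁻¹ᵁ U)) :
    Spec.map (i.app U) ≫ hU.isoSpec.inv = hV.isoSpec.inv ≫ i ∣_ U := by
  rw [← cancel_mono U.ι, Category.assoc, Category.assoc, morphismRestrict_ι]
  have := hU.SpecMap_appLE_fromSpec i hV le_rfl
  rw [Scheme.Hom.appLE_eq_app] at this
  exact this.trans (Category.assoc ..)

/-- The preimage of affine open subschemes under an affine morphism. -/
def preimageSite (i : Y ⟶ X) [IsAffineHom i] : X.AffineZariskiSite ⥤ Y.AffineZariskiSite :=
  Monotone.functor (f := fun U => (⟨i ⁻¹ᵁ U.1, U.2.preimage i⟩ : Y.AffineZariskiSite)) (by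
    -- The order of the site means being a basic open subset, not mere inclusion, so a function on
    -- the preimage of `U` has to be produced: the pullback of `f`.
    rintro V U ⟨f, hf⟩
    refine ⟨(i.app U.1).hom f, ?_⟩
    exact (i.preimage_basicOpen f).symm.trans (congrArg (i ⁻¹ᵁ ·) hf))

/-- A homomorphism from a graded algebra `S` on `X` to the direct image of a graded algebra `T`
on `Y` along an affine morphism `i : Y ⟶ X`. -/
structure GradedAlgebraSheaf.PushforwardHom (i : Y ⟶ X) [IsAffineHom i]
    (S : GradedAlgebraSheaf X) (T : GradedAlgebraSheaf Y) where
  hom (U : X.AffineZariskiSite) : S.grading (.op U) →+*ᵍ T.grading (.op ((preimageSite i).obj U))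
  hom_unit (U : X.AffineZariskiSite) (a : Γ(X, U.1)) :
    hom U ((S.unit.app (.op U)).hom a) =
      (T.unit.app (.op ((preimageSite i).obj U))).hom ((i.app U.1).hom a)
  hom_res {V U : X.AffineZariskiSite} (f : V ⟶ U) (x : S.algebra.obj (.op U)) :
    hom V (S.res f.op x) = T.res ((preimageSite i).map f).op (hom U x)

namespace GradedAlgebraSheaf

variable {i : Y ⟶ X} [IsAffineHom i] {S : GradedAlgebraSheaf X} {T : GradedAlgebraSheaf Y}
  (ψ : PushforwardHom i S T)

/-- Two squares are stacked: Proj over Spec by `projMap_projToSpec`, and Spec over the open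
subschemes by `specMap_app_isoSpec_inv`. -/
lemma PushforwardHom.projMap_projLocal (U : X.AffineZariskiSite)
    (hU : HomogeneousIdeal.irrelevant (T.grading (.op ((preimageSite i).obj U))) ≤
      (HomogeneousIdeal.irrelevant (S.grading (.op U))).map (ψ.hom U)) :
    Proj.map (ψ.hom U) hU ≫ S.projLocal U = T.projLocal ((preimageSite i).obj U) ≫ i ∣_ U.1 := by
  have h := projMap_projToSpec (ψ.hom U) (i.app U.1).hom (S.unit.app (.op U)).hom
    (T.unit.app (.op ((preimageSite i).obj U))).hom (S.unit_mem _)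
    (T.unit_mem (.op ((preimageSite i).obj U))) (ψ.hom_unit U) hU
  refine (Category.assoc ..).symm.trans ((congrArg (· ≫ U.2.isoSpec.inv) h).trans ?_)
  refine (Category.assoc ..).trans (Eq.trans ?_ (Category.assoc ..).symm)
  exact congrArg (projToSpec (T.grading (.op ((preimageSite i).obj U)))
    (T.unit.app (.op ((preimageSite i).obj U))).hom (T.unit_mem (.op ((preimageSite i).obj U))) ≫ ·)
    (specMap_app_isoSpec_inv i U.2 (U.2.preimage i))

lemma projMap_congr_of_eq {U : X.AffineZariskiSiteᵒᵖ} {V : Y.AffineZariskiSiteᵒᵖ}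
    {f g : S.grading U →+*ᵍ T.grading V} (h : f = g)
    (hf : HomogeneousIdeal.irrelevant (T.grading V) ≤
      (HomogeneousIdeal.irrelevant (S.grading U)).map f)
    (hg : HomogeneousIdeal.irrelevant (T.grading V) ≤
      (HomogeneousIdeal.irrelevant (S.grading U)).map g) : Proj.map f hf = Proj.map g hg := by
  subst h; rfl

/-- If a homomorphism from `S` to the direct image of `T` is surjective, and injective in positive
degrees, then the relative homogeneous spectra of `S` and `T` are isomorphic. -/
lemma PushforwardHom.nonempty_relativeProj_iso
    (hsurj : ∀ U n, ∀ b ∈ T.grading (.op ((preimageSite i).obj U)) n,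
      ∃ a ∈ S.grading (.op U) n, ψ.hom U a = b)
    (hinj : ∀ U n, 0 < n → ∀ a ∈ S.grading (.op U) n, ψ.hom U a = 0 → a = 0) :
    Nonempty (Over.mk S.relativeProjToBase ≅ Over.mk (T.relativeProjToBase ≫ i)) := by
  have hirr (U) := irrelevant_le_map_of_surjective (ψ.hom U) (hsurj U)
  have hiso (U) := isIso_projMap (ψ.hom U) (hsurj U) (hinj U) (hirr U)
  -- Only affine opens of `Y` of the form i⁻¹U are needed, and over these `ψ.hom U` gives the
  -- isomorphism of local pieces.
  refine nonempty_glued_iso i S.projGluingData T.projGluingData (preimageSite i)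
    (fun U => i ∣_ U.1) (fun U => isPullback_morphismRestrict i U.1)
    (NatIso.ofComponents (fun U => @asIso _ _ _ _ (Proj.map (ψ.hom U) (hirr U)) (hiso U)) ?_)
    (fun U => ψ.projMap_projLocal U (hirr U))
  intro V U f
  change Proj.map (T.res ((preimageSite i).map f).op) (T.irrelevant_le _) ≫
      Proj.map (ψ.hom U) (hirr U) =
    Proj.map (ψ.hom V) (hirr V) ≫ Proj.map (S.res f.op) (S.irrelevant_le f.op)
  -- By functoriality of Proj, naturality reduces to the compatibility of `ψ` with restriction.
  rw [← Proj.map_comp, ← Proj.map_comp]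
  refine projMap_congr_of_eq ?_ _ _
  ext x
  exact (ψ.hom_res f x).symm

end GradedAlgebraSheaf

end AffineMorphism

/-! ### Ideal sheaves containing the ideal of a closed subscheme -/

section IdealSheaf

open Scheme

variable {X Y : Scheme.{u}}

/-- Since `J` contains the ideal of `Y`, the closed subscheme of `J` already lies in `Y`.
Intersecting it with `Y` changes nothing, so the two closed immersions into `X` have the same
kernel. -/
lemma map_comap_of_ker_le (i : Y ⟶ X) [IsClosedImmersion i] (J : X.IdealSheafData)
    (h : i.ker ≤ J) : (J.comap i).map i = J := by
  let l := IsClosedImmersion.lift i J.subschemeι (by rwa [IdealSheafData.ker_subschemeι])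
  have hl : l ≫ i = J.subschemeι := IsClosedImmersion.lift_fac ..
  -- The projection is a monomorphism, being a base change of `i`, and the factorization `l` gives
  -- it a section.
  have : IsIso (pullback.snd i J.subschemeι) := by
    refine ⟨pullback.lift l (𝟙 _) 
      (by rw [hl, Category.id_comp]), ?_, pullback.lift_snd ..⟩
    rw [← cancel_mono (pullback.snd i J.subschemeι), Category.assoc, pullback.lift_snd,
      Category.comp_id, Category.id_comp]
  have key : (J.comap i).subschemeι ≫ i =
      ((J.comapIso i).hom ≫ pullback.snd i J.subschemeι) ≫ J.subschemeι := by
    rw [Category.assoc, ← pullback.condition, ← Category.assoc, IdealSheafData.comapIso_hom_fst]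
  rw [IdealSheafData.map, key, Scheme.Hom.ker_comp_of_isIso, IdealSheafData.ker_subschemeι]

/-- On sections over an affine open this reads: the preimage in R of J/K is J. It turns the ideal
whose linear type `eq_zero_of_toBlowup_eq_zero` requires into the one for which linear type is
assumed. -/
lemma comap_ideal_comap (i : Y ⟶ X) [IsClosedImmersion i] (J : X.IdealSheafData)
    (h : i.ker ≤ J) (U : X.affineOpens) :
    ((J.comap i).ideal ⟨i ⁻¹ᵁ U.1, U.2.preimage i⟩).comap (i.app U.1).hom = J.ideal U := by
  rw [← IdealSheafData.ideal_map_of_isAffineHom, map_comap_of_ker_le i J h]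

lemma le_jacobianIdeal {k : Type u} [CommRing k] (s : X ⟶ Spec (.of k))
    [LocallyOfFinitePresentation s] (D : X.IdealSheafData) : D ≤ jacobianIdeal s D :=
  fun _ => le_sup_left

end IdealSheaf

/-! ### The comparison map from the symmetric to the quasi-symmetric algebra -/

section SymToQuasiSym

open Scheme Scheme.AffineZariskiSite Opposite QCohModule

variable {k : Type u} [CommRing k] {X Y : Scheme.{u}} (i : Y ⟶ X) [IsAffineHom i]
  (s : Y ⟶ Spec (.of k)) (I : Y.IdealSheafData)

/-- The identification of the sections of the direct image of `I` over `U` with the sections of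
`I` over the preimage of `U`. -/
def pushforwardIdealSections (U : X.AffineZariskiSite) :
    (pushforwardIdeal i I).obj (.op U) →ₛₗ[(i.app U.1).hom]
      I.ideal ⟨i ⁻¹ᵁ U.1, U.2.preimage i⟩ where
  toFun x := x
  map_add' _ _ := rfl
  map_smul' _ _ := rfl

/-- The underlying map is the identity; only the scalars change, from functions on `U` to functions
on its preimage. -/
lemma pushforwardIdealSections_bijective (U : X.AffineZariskiSite) :
    Function.Bijective (pushforwardIdealSections i I U) := Function.bijective_id

/-- The canonical homomorphism from the symmetric algebra of `i_* I` to the direct image of the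
quasi-symmetric blow-up algebra of `I`, over an affine open `U`. -/
def symToQuasiSymAt (U : X.AffineZariskiSite) :
    (pushforwardIdeal i I).symAt (.op U) →+*
      QuasiSym (A := Γ(Y, i ⁻¹ᵁ U.1)) (scalars s _) (I.ideal ⟨i ⁻¹ᵁ U.1, U.2.preimage i⟩) :=
  (QuasiSym.mk _ _).comp (symMap (i.app U.1).hom (pushforwardIdealSections i I U))

/-- The canonical homomorphism from the symmetric algebra of `i_* I` to the direct image of the
quasi-symmetric blow-up algebra of `I`. -/
def symToQuasiSym : GradedAlgebraSheaf.PushforwardHom i (pushforwardIdeal i I).sym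
    (quasiSymSheaf s I) where
  hom U :=
    { toRingHom := symToQuasiSymAt i s I U
      map_mem {n x} hx := ⟨_, symMap_mem _ _ hx, rfl⟩ }
  hom_unit U a := congrArg (QuasiSym.mk (A := Γ(Y, i ⁻¹ᵁ U.1)) (scalars s _)
    (I.ideal ⟨i ⁻¹ᵁ U.1, U.2.preimage i⟩)) (symMap_algebraMap _ _ a)
  hom_res {V U} f x := by
    -- Restriction of quasi-symmetric algebras is induced from the symmetric algebras, so the square
    -- can be checked before passing to the quotient, hence on scalars and on generators.
    suffices h : (symMap (i.app V.1).hom (pushforwardIdealSections i I V)).comp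
          ((pushforwardIdeal i I).symRes f.op) =
        (symMap (preimageRes i f.op) (idealRes _ _ (preimageRes i f.op)
          (ideal_le_comap_preimageRes i I f.op))).comp
            (symMap (i.app U.1).hom (pushforwardIdealSections i I U)) from
      congrArg (QuasiSym.mk (A := Γ(Y, i ⁻¹ᵁ V.1)) (scalars s _)
        (I.ideal ⟨i ⁻¹ᵁ V.1, V.2.preimage i⟩)) congr($h x)
    refine sym_ringHom_ext ?_ ?_
    · intro a
      simp only [RingHom.comp_apply, symRes, symMap_algebraMap]
      exact congrArg _ (preimageRes_app i f.op a).symm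
    · intro m
      simp only [RingHom.comp_apply, symRes, symMap_ι]
      rfl

end SymToQuasiSym

/-! ### The isomorphism for ideal sheaves of linear type -/

section LinearType

open Scheme Scheme.AffineZariskiSite Opposite QCohModule

variable {k : Type u} [CommRing k] {X Y : Scheme.{u}} (i : Y ⟶ X) (s : X ⟶ Spec (.of k))

/-- This makes restriction of functions from X to the closed subscheme a homomorphism of k-algebras,
as is required of an ambient scheme. -/
lemma app_comp_scalars (U : X.Opens) :
    (i.app U).hom.comp (scalars s U) = scalars (i ≫ s) (i ⁻¹ᵁ U) := by
  rw [scalars, scalars, ← CommRingCat.hom_comp]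
  refine congrArg CommRingCat.Hom.hom ?_
  rw [Scheme.Hom.comp_appTop, Category.assoc, Category.assoc, Category.assoc, i.naturality]
  rfl

/-- Let `J` be an ideal sheaf of linear type on a `k`-scheme `X`, and let `i : Y ⟶ X` be a closed
subscheme which contains the closed subscheme defined by `J`. Then the relative homogeneous spectrum
of the symmetric algebra of the ideal sheaf `J 𝒪_Y`, considered as a module on `X`, is isomorphic
to the quasi-symmetric blow-up of `Y` along this ideal sheaf. -/
theorem nonempty_projSym_iso_quasiBlowup [IsClosedImmersion i] (J : X.IdealSheafData)
    (hJ : i.ker ≤ J) (hlin : IsLinearType J) :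
    Nonempty (Over.mk (pushforwardIdeal i (J.comap i)).sym.relativeProjToBase ≅
      Over.mk (quasiBlowupToBase (i ≫ s) (J.comap i) ≫ i)) := by
  have hi (U : X.AffineZariskiSite) : Function.Surjective (i.app U.1).hom :=
    i.app_surjective U.1 U.2
  refine (symToQuasiSym i (i ≫ s) (J.comap i)).nonempty_relativeProj_iso ?_ ?_
  -- A homogeneous element of the quotient has a representative in Sym_A(I) of the same degree, and
  -- this lifts to Sym_R(I) because R → A is surjective.
  · rintro U n _ ⟨y, hy, rfl⟩
    obtain ⟨x, hx, rfl⟩ := exists_symMap_eq_of_mem _ (hi U) (pushforwardIdealSections i (J.comap i) U)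
      (pushforwardIdealSections_bijective i _ U).2 hy
    exact ⟨x, hx, rfl⟩
  · intro U n hn x hx h0
    -- The open `U` of X itself serves as ambient scheme of its intersection with `Y`. An element
    -- that vanishes in the limit vanishes in the blow-up algebra of this one embedding, and by
    -- linear type that is enough.
    let R : Ambient (scalars (i ≫ s) (i ⁻¹ᵁ U.1)) :=
      { ring := Γ(X, U.1)
        str := scalars s U.1
        proj := (i.app U.1).hom
        surjective := hi U
        comm := app_comp_scalars i s U.1 }
    have h1 := (mem_quasiSymIdeal _ _).mp ((QuasiSym.mk_eq_zero _ _).mp h0) R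
    refine eq_zero_of_toBlowup_eq_zero (i.app U.1).hom (hi U) _ ?_
      (pushforwardIdealSections i (J.comap i) U) (pushforwardIdealSections_bijective i _ U) hn hx h1
    rw [comap_ideal_comap i J hJ U]
    exact hlin U

end LinearType

end QuasiBlowup

end

theorem mainTheorem4 (k : Type u) [Field k] [IsAlgClosed k] [CharZero k]
    (X : Scheme.{u}) (s : X ⟶ Spec (.of k)) [IsIntegral X] [IsSeparated s] [QuasiCompact s]
    [LocallyOfFiniteType s] [Smooth s]
    (D : X.IdealSheafData) (hD : QuasiBlowup.IsEffectiveCartier D) [IsReduced D.subscheme]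
    (hlin : QuasiBlowup.IsLinearType (QuasiBlowup.jacobianIdeal s D)) :
    Nonempty
      (Over.mk (QuasiBlowup.QCohModule.pushforwardIdeal D.subschemeι
          ((QuasiBlowup.jacobianIdeal s D).comap D.subschemeι)).sym.relativeProjToBase ≅
        Over.mk (QuasiBlowup.quasiBlowupToBase (D.subschemeι ≫ s)
          ((QuasiBlowup.jacobianIdeal s D).comap D.subschemeι) ≫ D.subschemeι)) := by
  refine QuasiBlowup.nonempty_projSym_iso_quasiBlowup D.subschemeι s _ ?_ hlin
  -- The remaining condition is that the singular subscheme lies on D: the Jacobian ideal contains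
  -- the equation of D by its definition.
  rw [Scheme.IdealSheafData.ker_subschemeι]
  exact QuasiBlowup.le_jacobianIdeal s D
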